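/- **Conventions.** A non-commutative probability space $(\mathcal A,\varphi)$ is a unital complex algebra with a linear functional $\varphi$, $\varphi(1)=1$. Subalgebras $\mathcal A_i$ are free if $\varphi(a_1\cdots a_n)=0$ for $n\ge 1$ whenever $a_j\in\mathcal A_{i_j}$, $\varphi(a_j)=0$ and $i_j\ne i_{j+1}$. Elements $(T_i)_{i\in I}$, $I$ finite, are free (resp. $*$-free) if the unital subalgebras (resp. unital $*$-subalgebras) generated by the single $T_i$ are free. Put $G_a(\zeta)=\varphi((\zeta-a)^{-1})=\sum_{n\ge0}\varphi(a^n)\zeta^{-n-1}$. An $R$-transform of $a$ is $R_a(z)=c_1z+c_2z^2+\cdots$ such that $K_a(z)=\frac1z(1+R_a(z))$ is the inverse of $G_a$ under composition at infinity. For elements $S_i$ write $W_n(S)=\sum_{i_1\ne i_2\ne\cdots\ne i_n}S_{i_1}S_{i_2}\cdots S_{i_n}$ (neighbouring indices differ). **Theorem.** (1) *Formal version.* Let $(\mathcal A,\varphi)$ be a non-commutative probability space. Every $a\in\mathcal A$ has a unique $R$-transform $R_a\in z\,\mathbb C[[z]]$, where all identities are between formal series. If $T_i\in\mathcal A$ are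 free with $R$-transforms $R_i$, $K_i=\frac1z(1+R_i)$, $K=\frac1z(1+\sum_i R_i)$ and $T=\sum_i T_i$, then $K_i-T_i$ and $K-T$ have formal inverses; $(K_i-T_i)^{-1}=z(1+S_i)$ with $S_i\in\mathcal A[[z]]$ and $\varphi(S_i)=0$ coefficientwise; $$(K-T)^{-1}=z\Bigl(1+\sum_{n\ge1}W_n(S)\Bigr)$$ with convergence in the sense that each coefficient is eventually constant; $\varphi((K-T)^{-1})=z$ coefficientwise; and $R_T=\sum_i R_i$. (2) *Analytic version near $z=0$.* Let $\mathcal A$ be a unital complex Banach algebra and $\varphi$ a continuous linear functional with $\varphi(1)=1$. Every $a\in\mathcal A$ has an $R$-transform analytic at $0$, unique as a germ. If the $T_i$ are free with analytic $R$-transforms $R_i$, then for all sufficiently small $z\neq0$ the $K_i(z)-T_i$ and $K(z)-T$ are invertible, $(K_i(z)-T_i)^{-1}=z(1+S_i)$ with $\varphi(S_i)=0$, the series $\sum_{n\ge1}W_n(S)$ converges in $\mathcal A$, $(K(z)-T)^{-1}=z(1+\sum_{n\ge1}W_n(S))$ and $\varphi((K(z)-T)^{-1})=z$. Moreover $\sum_i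 R_i$ is the $R$-transform of $T$. (3) *At a given point.* Let $\mathcal A$ be a unital $C^*$-algebra with a state $\varphi$, $T_i\in\mathcal A$ $*$-free, $T=\sum_i T_i$, $z\ne0$ and $r_i\in\mathbb C$ such that, with $K_i=\frac1z(1+r_i)$, each $K_i-T_i$ is invertible and $G_{T_i}(K_i)=z$. Put $K=\frac1z(1+\sum_i r_i)$ and define $S_i$ by $(K_i-T_i)^{-1}=z(1+S_i)$. Let $\|a\|_2=\varphi(a^*a)^{1/2}$ and let $L^2(\varphi)$ be the corresponding Hilbert space. Then $\varphi(S_i)=0$, and: (a) If the family of all products $S_{i_1}\cdots S_{i_n}$ with $n\ge1$, $i_1\ne i_2\ne\cdots\ne i_n$ is (unconditionally) summable in $\mathcal A$, with sum $s$, then $K-T$ is invertible, $(K-T)^{-1}=z(1+s)$ and $\varphi((K-T)^{-1})=z$. (b) If $\sum_i\frac{\|S_i\|_2^2}{1+\|S_i\|_2^2}<1$, then $\sum_{n\ge1}W_n(S)$ converges in $L^2(\varphi)$, and $\psi=z(1+\sum_{n\ge1}W_n(S))\in L^2(\varphi)$ is the resolvent of $T$ at $K$ in $L^2(\varphi)$: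 $(K-T)\psi=1$, and $\psi=(K-T)^{-1}$ if $K-T$ is invertible in $\mathcal A$. Furthermore $\langle 1,\psi\rangle=z$ (inner product linear in the second argument) and $$\|\psi\|_2^2=|z|^2\Bigl(1+\sum_{n\ge1}\ \sum_{i_1\ne\cdots\ne i_n}\|S_{i_1}\|_2^2\cdots\|S_{i_n}\|_2^2\Bigr)=|z|^2\Bigl(1-\sum_i\tfrac{\|S_i\|_2^2}{1+\|S_i\|_2^2}\Bigr)^{-1}=|z|^2\Bigl(1-\sum_i\Bigl(1-\tfrac{|z|^2}{\|(K_i-T_i)^{-1}\|_2^2}\Bigr)\Bigr)^{-1},$$ where the series of numbers converges. (c) Suppose in addition that $\varphi$ is faithful and tracial. If $\sum_{n\ge1}W_n(S)$ converges in $L^2(\varphi)$, then $K-T$ is invertible in $\mathcal A$ (the resolvent is bounded in operator norm), $\sum_{n\ge1}W_n(S)$ converges in operator norm, $(K-T)^{-1}=z(1+\sum_{n\ge1}W_n(S))$ and $\varphi((K-T)^{-1})=z$. -/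

import Mathlib

open scoped ComplexOrder PowerSeries

universe u v

namespace FreeProb

/-! ### Freeness -/

/-- Free independence of a family of subalgebras of `(A, φ)`: `φ (a₁ ⋯ aₙ) = 0` (`n ≥ 1`) whenever
`aⱼ ∈ B (iⱼ)`, `φ (aⱼ) = 0` and neighbouring indices differ. The word `a₁ ⋯ aₙ` is a list of
pairs `(iⱼ, aⱼ)`. -/
def FreeSubalgebras {ι A : Type*} [Ring A] [Algebra ℂ A] (φ : A →ₗ[ℂ] ℂ)
    (B : ι → Subalgebra ℂ A) : Prop :=
  ∀ l : List (ι × A), l ≠ [] → (∀ p ∈ l, p.2 ∈ B p.1 ∧ φ p.2 = 0) →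
    l.IsChain (fun p q => p.1 ≠ q.1) → φ (l.map Prod.snd).prod = 0

/-- Free random variables: the unital subalgebras that they generate are free. -/
def IsFree {ι A : Type*} [Ring A] [Algebra ℂ A] (φ : A →ₗ[ℂ] ℂ) (T : ι → A) : Prop :=
  FreeSubalgebras φ fun i => Algebra.adjoin ℂ {T i}

/-- `*`-free random variables: the unital `*`-subalgebras that they generate are free. -/
def IsStarFree {ι A : Type*} [Ring A] [StarRing A] [Algebra ℂ A] [StarModule ℂ A]
    (φ : A →ₗ[ℂ] ℂ) (T : ι → A) : Prop :=
  FreeSubalgebras φ fun i => (StarAlgebra.adjoin ℂ {T i}).toSubalgebra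

/-! ### Sums of alternating products -/

/-- Words of length `n` over `ι` in which neighbouring letters differ. -/
def IsAlternating {ι : Type*} (w : List ι) : Prop := w.IsChain (· ≠ ·)

/-- The finite set of alternating words of length `n`. -/
noncomputable def alternatingWords (ι : Type*) [Finite ι] (n : ℕ) : Finset (List ι) :=
  ((List.finite_length_eq ι n).subset (fun _ hw => hw.1) :
    {w : List ι | w.length = n ∧ IsAlternating w}.Finite).toFinset

/-- `∑_{i₁ ≠ i₂ ≠ ⋯ ≠ iₙ} S_{i₁} S_{i₂} ⋯ S_{iₙ}`. -/
noncomputable def altSum {ι B : Type*} [Finite ι] [Semiring B] (S : ι → B) (n : ℕ) : B :=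
  ∑ w ∈ alternatingWords ι n, (w.map S).prod

/-! ### Formal transforms in an arbitrary non-commutative probability space -/

/-- The formal Cauchy transform in the variable `w = 1/ζ`:
`G_a(1/w) = ∑ φ(aⁿ) wⁿ⁺¹`. -/
noncomputable def formalCauchy {A : Type*} [Ring A] [Algebra ℂ A] (φ : A →ₗ[ℂ] ℂ) (a : A) :
    ℂ⟦X⟧ :=
  PowerSeries.X * PowerSeries.mk fun n => φ (a ^ n)

/-- `1 / K(z) = z (1 + R(z))⁻¹` for `K(z) = (1 + R(z)) / z`. -/
noncomputable def formalInvK (R : ℂ⟦X⟧) : ℂ⟦X⟧ := PowerSeries.X * (1 + R)⁻¹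

/-- `R(z) = c₁ z + c₂ z² + ⋯` is the formal `R`-transform of `a`: the series
`K(z) = (1 + R(z)) / z` is the compositional inverse of `G_a`. The two equations are `G_a(K(z)) = z`
and, with `w = 1/ζ`, `1 / K(G_a(1/w)) = w`. -/
def IsFormalRTransform {A : Type*} [Ring A] [Algebra ℂ A] (φ : A →ₗ[ℂ] ℂ) (a : A)
    (R : ℂ⟦X⟧) : Prop :=
  PowerSeries.constantCoeff R = 0 ∧
  PowerSeries.subst (formalInvK R) (formalCauchy φ a) = (PowerSeries.X : ℂ⟦X⟧) ∧
  PowerSeries.subst (formalCauchy φ a) (formalInvK R) = (PowerSeries.X : ℂ⟦X⟧)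

/-- The formal power series `z (K(z) - a) = 1 + R(z) - z a` with coefficients in `A`, where
`K(z) = (1 + R(z)) / z`. So `(K(z) - a)⁻¹` is `z` times the inverse of this series. -/
noncomputable def formalPencil {A : Type*} [Ring A] [Algebra ℂ A] (a : A) (R : ℂ⟦X⟧) : A⟦X⟧ :=
  1 + PowerSeries.map (algebraMap ℂ A) R - PowerSeries.X * PowerSeries.C a

/-! ### Analytic transforms -/

/-- The Cauchy transform `G_a(ζ) = φ((ζ - a)⁻¹)`. -/
noncomputable def cauchyTransform {A : Type*} [Ring A] [Algebra ℂ A] (φ : A →ₗ[ℂ] ℂ) (a : A)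
    (ζ : ℂ) : ℂ :=
  φ (resolvent a ζ)

/-- `K(z) = (1 + R(z)) / z`. -/
noncomputable def kTransform (R : ℂ → ℂ) (z : ℂ) : ℂ := (1 + R z) / z

/-- `R` is the `R`-transform of `a` near `0`: it is analytic at `0`, vanishes there, and
`K(z) = (1 + R(z)) / z` is the compositional inverse of `G_a` near infinity. -/
def IsRTransform {A : Type*} [Ring A] [Algebra ℂ A] (φ : A →ₗ[ℂ] ℂ) (a : A)
    (R : ℂ → ℂ) : Prop :=
  AnalyticAt ℂ R 0 ∧ R 0 = 0 ∧
  (∀ᶠ z in nhdsWithin (0 : ℂ) {0}ᶜ,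
    kTransform R z ∈ resolventSet ℂ a ∧ cauchyTransform φ a (kTransform R z) = z) ∧
  (∀ᶠ ζ in Bornology.cobounded ℂ,
    ζ ∈ resolventSet ℂ a ∧ kTransform R (cauchyTransform φ a ζ) = ζ)

/-! ### The space `L²(φ)` -/

section L2

variable {A : Type*} [CStarAlgebra A] [PartialOrder A] [StarOrderedRing A]

/-- `‖a‖₂ = φ(a* a)^{1/2}`. -/
noncomputable def l2Norm (φ : A →ₚ[ℂ] ℂ) (a : A) : ℝ := Real.sqrt (φ (star a * a)).re

/-- The canonical map of `A` into `L²(φ)`, the completion of `A` for `‖·‖₂`. -/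
noncomputable def toL2 (φ : A →ₚ[ℂ] ℂ) (a : A) : φ.GNS :=
  ((φ.toPreGNS a : φ.PreGNS) : UniformSpace.Completion φ.PreGNS)

theorem norm_toL2 (φ : A →ₚ[ℂ] ℂ) (a : A) : ‖toL2 φ a‖ = l2Norm φ a := by
  simp [toL2, l2Norm, PositiveLinearMap.preGNS_norm_def]

end L2

end FreeProb

/-! Put `V i = z (K_i - T_i) = 1 + r_i - z T_i`, with inverse `1 + S_i`. Since `1 - V i = z T_i -
r_i` is additive in `i`, `z (K - T) = 1 - ∑ (1 - V i)`. Let `W` be the sum of all alternating words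
in the `S_i`, including the empty one, and `F i` the part beginning with `i`. Removing the first
letter gives `F i = S_i (W - F i)`, hence `F i = (1 - V i) W`; summing over `i` gives `(1 - ∑ (1 - V
i)) W = 1`. The finite form with an explicit error, `mul_sum_altSum`, serves every version of the
theorem.

The condition `G_{T_i}(K_i) = z` says precisely `φ (S_i) = 0`. As `S_i` lies in the algebra
generated by `T_i`, or in its closure, freeness makes `φ` vanish on every nonempty alternating word,
so `φ ((K - T)⁻¹) = z`: the sum of the `R`-transforms is the `R`-transform of the sum.

What differs is the convergence. Formally, `z` divides `S_i`, so words of length `n` are divisible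
by `zⁿ`. In a Banach algebra `S_i → 0` as `z → 0`. In `L²(φ)` alternating words are orthogonal
(`FreeSubalgebras.star_word_mul_word`), so convergence and norms reduce to the scalar identity for
`x i = ‖S_i‖₂²`.

For (c), let `E i` project `L²(φ)` onto the words beginning with `i`. Centredness gives `(1 - E i)
S_i (1 - E i) = 0`, so an alternating word is creations, at most one diagonal term, then
annihilations (`altSumFrom_succ_succ_eq`). Powers of the total creation operator are bounded by the
scalar sums (`norm_sum_pow_sq_le`), which decay geometrically because `∑ x i / (1 + x i) < 1` is an
open condition. Annihilations are adjoints of creations by `S_i*`, equally large by traciality, and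
faithfulness makes the GNS representation isometric. -/

namespace FreeProb

open Filter Topology

/-! ### Alternating words and the algebraic resolvent identity. -/

section AltSum

theorem isAlternating_cons {ι : Type*} {i : ι} {w : List ι} :
    IsAlternating (i :: w) ↔ w.head? ≠ some i ∧ IsAlternating w := by
  rw [IsAlternating, List.isChain_cons]
  constructor
  · rintro ⟨h1, h2⟩
    exact ⟨fun h => h1 i (by simp [h]) rfl, h2⟩
  · rintro ⟨h1, h2⟩
    exact ⟨fun y hy h => h1 (by simpa [h] using hy), h2⟩

theorem list_map_prod_nonneg {ι : Type*} {x : ι → ℝ} (hx : ∀ i, 0 ≤ x i) (w : List ι) :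
    0 ≤ (w.map x).prod :=
  List.prod_nonneg (by simpa using fun i _ => hx i)

variable {ι : Type*} [Finite ι]

theorem mem_alternatingWords {n : ℕ} {w : List ι} :
    w ∈ alternatingWords ι n ↔ w.length = n ∧ IsAlternating w := by
  simp [alternatingWords]

/-- The alternating words of length `n` that begin with `i`. -/
noncomputable def alternatingWordsFrom (n : ℕ) (i : ι) : Finset (List ι) :=
  open scoped Classical in (alternatingWords ι n).filter fun w => w.head? = some i

theorem mem_alternatingWordsFrom {n : ℕ} {i : ι} {w : List ι} :
    w ∈ alternatingWordsFrom n i ↔ (w.length = n ∧ IsAlternating w) ∧ w.head? = some i := by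
  simp [alternatingWordsFrom, mem_alternatingWords]

/-- The part of `altSum S n` that consists of the words beginning with `i`. -/
noncomputable def altSumFrom {B : Type*} [Semiring B] (S : ι → B) (n : ℕ) (i : ι) : B :=
  ∑ w ∈ alternatingWordsFrom n i, (w.map S).prod

@[simp] theorem altSum_zero {B : Type*} [Semiring B] (S : ι → B) : altSum S 0 = 1 := by
  have : alternatingWords ι 0 = {[]} := by
    ext w
    simp only [mem_alternatingWords, List.length_eq_zero_iff, Finset.mem_singleton]
    exact ⟨fun h => h.1, fun h => ⟨h, by simp [h, IsAlternating]⟩⟩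
  simp [altSum, this]

@[simp] theorem altSumFrom_zero {B : Type*} [Semiring B] (S : ι → B) (i : ι) :
    altSumFrom S 0 i = 0 := by
  refine Finset.sum_eq_zero fun w hw => ?_
  rw [mem_alternatingWordsFrom] at hw
  simp [List.length_eq_zero_iff.1 hw.1.1] at hw

/-- Removing the first letter `i` leaves exactly the words of length `n` not beginning with `i`. The
additive form avoids subtraction and so makes sense in a semiring. -/
theorem altSumFrom_succ_add {B : Type*} [Semiring B] (S : ι → B) (n : ℕ) (i : ι) :
    altSumFrom S (n + 1) i + S i * altSumFrom S n i = S i * altSum S n := by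
  classical
  have h1 : altSumFrom S (n + 1) i =
      ∑ w ∈ (alternatingWords ι n).filter (fun w => ¬ w.head? = some i),
        S i * (w.map S).prod := by
    symm
    refine Finset.sum_bij' (fun w _ => i :: w) (fun w _ => w.tail) ?_ ?_ ?_ ?_ ?_
    · intro w hw
      rw [Finset.mem_filter, mem_alternatingWords] at hw
      rw [mem_alternatingWordsFrom, isAlternating_cons]
      simp [hw.1.1, hw.1.2, hw.2]
    · intro w hw
      rw [mem_alternatingWordsFrom] at hw
      rcases w with _ | ⟨j, w⟩
      · simp at hw
      · rw [isAlternating_cons] at hw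
        rw [Finset.mem_filter, mem_alternatingWords]
        simp only [List.length_cons, List.head?_cons, Option.some.injEq,
          Nat.add_right_cancel_iff] at hw
        obtain ⟨⟨h1, h2, h3⟩, rfl⟩ := hw
        exact ⟨⟨h1, h3⟩, h2⟩
    · intro w _; rfl
    · intro w hw
      rw [mem_alternatingWordsFrom] at hw
      rcases w with _ | ⟨j, w⟩
      · simp at hw
      · simp at hw; simp [hw.2]
    · intro w _; simp
  rw [h1, altSumFrom, alternatingWordsFrom, ← Finset.mul_sum, ← mul_add, altSum, add_comm]
  congr 1
  convert Finset.sum_filter_add_sum_filter_not (alternatingWords ι n)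
    (fun w => w.head? = some i) _ using 3

theorem altSumFrom_succ {B : Type*} [Ring B] (S : ι → B) (n : ℕ) (i : ι) :
    altSumFrom S (n + 1) i = S i * (altSum S n - altSumFrom S n i) := by
  rw [mul_sub, ← altSumFrom_succ_add, add_sub_cancel_right]

theorem altSum_succ [Fintype ι] {B : Type*} [Semiring B] (S : ι → B) (n : ℕ) :
    altSum S (n + 1) = ∑ i, altSumFrom S (n + 1) i := by
  classical
  simp only [altSumFrom, alternatingWordsFrom]
  rw [Finset.sum_comm' (t' := alternatingWords ι (n + 1))
    (s' := fun w => Finset.univ.filter fun i => w.head? = some i)]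
  · refine Finset.sum_congr rfl fun w hw => ?_
    rw [mem_alternatingWords] at hw
    rcases w with _ | ⟨j, w⟩
    · simp at hw
    · rw [Finset.sum_const]
      have : (Finset.univ.filter fun i => (j :: w).head? = some i) = {j} := by
        ext i; simp [eq_comm]
      rw [this]; simp
  · intro i w; simp [and_comm]

theorem map_altSum {B C : Type*} [Semiring B] [Semiring C] (f : B →+* C) (S : ι → B) (n : ℕ) :
    f (altSum S n) = altSum (fun i => f (S i)) n := by
  simp [altSum, map_list_prod, Function.comp_def]

/-- Reversing a word keeps it alternating. This later turns right inverses into left inverses. -/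
theorem altSum_op {B : Type*} [Semiring B] (S : ι → B) (n : ℕ) :
    altSum (fun i => MulOpposite.op (S i)) n = MulOpposite.op (altSum S n) := by
  rw [altSum, altSum, Finset.op_sum]
  refine Finset.sum_bij' (fun w _ => w.reverse) (fun w _ => w.reverse) ?_ ?_ ?_ ?_ ?_
  · intro w hw
    rw [mem_alternatingWords] at *
    refine ⟨by simpa using hw.1, ?_⟩
    rw [IsAlternating, List.isChain_reverse]
    exact hw.2.imp fun _ _ h => h.symm
  · intro w hw
    rw [mem_alternatingWords] at *
    refine ⟨by simpa using hw.1, ?_⟩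
    rw [IsAlternating, List.isChain_reverse]
    exact hw.2.imp fun _ _ h => h.symm
  · simp
  · simp
  · intro w _
    rw [MulOpposite.op_list_prod]
    simp [Function.comp_def]

/-- The finite form of the resolvent formula: `1 - ∑ (1 - (1 + Sᵢ)⁻¹)` times the sum of all
alternating words of length at most `N` is `1` up to words of length `N + 1`. -/
theorem mul_sum_altSum [Fintype ι] {B : Type*} [Ring B] (S V : ι → B)
    (hV : ∀ i, V i * (1 + S i) = 1) (N : ℕ) :
    (1 - ∑ i, (1 - V i)) * ∑ n ∈ Finset.range (N + 1), altSum S n =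
      1 - ∑ i, V i * altSumFrom S (N + 1) i := by
  have hVS : ∀ i, V i * S i = 1 - V i := fun i => by
    rw [← hV i]; noncomm_ring
  induction N with
  | zero => simp [altSumFrom_succ, hVS]
  | succ N ih =>
    rw [Finset.sum_range_succ, mul_add, ih]
    -- The first-letter recursion multiplied by `V i`, where `V i * S i = 1 - V i`; only the left
    -- inverse `V i` of `1 + S i` enters.
    have h : ∀ i, V i * altSumFrom S (N + 1 + 1) i = (1 - V i) * altSum S (N + 1)
        - altSumFrom S (N + 1) i + V i * altSumFrom S (N + 1) i := fun i => by
      rw [altSumFrom_succ, ← mul_assoc, hVS]; noncomm_ring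
    have h' : ∑ i, V i * altSumFrom S (N + 1 + 1) i = (∑ i, (1 - V i)) * altSum S (N + 1)
        - altSum S (N + 1) + ∑ i, V i * altSumFrom S (N + 1) i := by
      rw [Finset.sum_congr rfl fun i _ => h i, Finset.sum_add_distrib, altSum_succ S N,
        Finset.sum_mul, ← Finset.sum_sub_distrib]
    rw [h', sub_mul, one_mul]
    abel

theorem altSum_smul {B R : Type*} [CommSemiring R] [Semiring B] [Algebra R B] (t : R) (S : ι → B)
    (n : ℕ) : altSum (fun i => t • S i) n = t ^ n • altSum S n := by
  rw [altSum, altSum, Finset.smul_sum]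
  refine Finset.sum_congr rfl fun w hw => ?_
  rw [← (mem_alternatingWords.1 hw).1]
  clear hw
  induction w with
  | nil => simp
  | cons i w ih =>
    simp only [List.map_cons, List.prod_cons, ih, List.length_cons, pow_succ', mul_smul,
      smul_mul_assoc, mul_smul_comm]
    exact smul_comm _ _ _

theorem altSum_nonneg {x : ι → ℝ} (hx : ∀ i, 0 ≤ x i) (n : ℕ) : 0 ≤ altSum x n :=
  Finset.sum_nonneg fun w _ => list_map_prod_nonneg hx w

theorem altSumFrom_nonneg {x : ι → ℝ} (hx : ∀ i, 0 ≤ x i) (n : ℕ) (i : ι) :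
    0 ≤ altSumFrom x n i :=
  Finset.sum_nonneg fun w _ => list_map_prod_nonneg hx w

theorem altSumFrom_le {x : ι → ℝ} (hx : ∀ i, 0 ≤ x i) (n : ℕ) (i : ι) :
    altSumFrom x n i ≤ altSum x n := by
  classical
  exact Finset.sum_le_sum_of_subset_of_nonneg (Finset.filter_subset _ _)
    fun w _ _ => list_map_prod_nonneg hx w

theorem inv_one_add_mul {x : ℝ} (hx : 0 ≤ x) : (1 + x)⁻¹ * (1 + x) = 1 :=
  inv_mul_cancel₀ (by positivity)

theorem one_sub_inv_one_add {x : ℝ} (hx : 0 ≤ x) : 1 - (1 + x)⁻¹ = x / (1 + x) := by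
  field_simp; ring

/-- For non-negative numbers, `∑ xᵢ / (1 + xᵢ) < 1` makes the sums over alternating words
summable. -/
theorem summable_altSum_of_lt_one [Fintype ι] {x : ι → ℝ} (hx : ∀ i, 0 ≤ x i)
    (h : ∑ i, x i / (1 + x i) < 1) : Summable fun n => altSum x n := by
  refine summable_of_sum_range_le (c := (1 - ∑ i, x i / (1 + x i))⁻¹) (altSum_nonneg hx) fun n => ?_
  have key := mul_sum_altSum x (fun i => (1 + x i)⁻¹) (fun i => inv_one_add_mul (hx i)) n
  simp only [one_sub_inv_one_add (hx _)] at key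
  -- The error term is non-negative, so the identity bounds all partial sums by the inverse of the
  -- first factor.
  have h0 : 0 ≤ ∑ i, (1 + x i)⁻¹ * altSumFrom x (n + 1) i :=
    Finset.sum_nonneg fun i _ => mul_nonneg (by have := hx i; positivity) (altSumFrom_nonneg hx _ _)
  rw [← one_div, le_div_iff₀ (by linarith), mul_comm]
  refine le_trans ?_ (key.le.trans (by linarith))
  refine mul_le_mul_of_nonneg_left ?_ (by linarith)
  rw [Finset.sum_range_succ]
  linarith [altSum_nonneg hx n]

/-- The limit of the finite identity: the error is dominated by the terms of a convergent series. -/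
theorem hasSum_altSum_mul [Fintype ι] {x : ι → ℝ} (hx : ∀ i, 0 ≤ x i) {σ : ℝ}
    (h : HasSum (fun n => altSum x (n + 1)) σ) :
    (1 - ∑ i, x i / (1 + x i)) * (1 + σ) = 1 := by
  have h0 : HasSum (fun n => altSum x n) (1 + σ) := by
    rw [← hasSum_nat_add_iff' 1]; simpa using h
  have h1 := ((h0.tendsto_sum_nat.comp (tendsto_add_atTop_nat 1)).const_mul
    (1 - ∑ i, x i / (1 + x i)))
  have h2 : Tendsto (fun N => 1 - ∑ i, (1 + x i)⁻¹ * altSumFrom x (N + 1) i) atTop (𝓝 1) := by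
    have : ∀ i, Tendsto (fun N => (1 + x i)⁻¹ * altSumFrom x (N + 1) i) atTop (𝓝 0) := fun i => by
      rw [← mul_zero (1 + x i)⁻¹]
      refine Tendsto.const_mul _ ?_
      exact squeeze_zero (fun n => altSumFrom_nonneg hx _ _) (fun n => altSumFrom_le hx _ _)
        h.summable.tendsto_atTop_zero
    simpa using (tendsto_finsetSum Finset.univ fun i _ => this i).const_sub 1
  refine tendsto_nhds_unique (h1.congr fun N => ?_) h2
  have key := mul_sum_altSum x (fun i => (1 + x i)⁻¹) (fun i => inv_one_add_mul (hx i)) N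
  simp only [one_sub_inv_one_add (hx _)] at key
  exact key

theorem lt_one_of_summable_altSum [Fintype ι] {x : ι → ℝ} (hx : ∀ i, 0 ≤ x i)
    (h : Summable (fun n => altSum x (n + 1))) : ∑ i, x i / (1 + x i) < 1 := by
  obtain ⟨σ, hσ⟩ := h
  have h1 := hasSum_altSum_mul hx hσ
  have h2 : 0 ≤ σ := hσ.nonneg fun n => altSum_nonneg hx _
  by_contra! h3
  nlinarith

/-- If the sums over alternating words are summable, they decay geometrically. -/
theorem exists_summable_pow_mul_altSum [Fintype ι] {x : ι → ℝ} (hx : ∀ i, 0 ≤ x i)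
    (h : ∑ i, x i / (1 + x i) < 1) :
    ∃ t : ℝ, 1 < t ∧ Summable fun n => t ^ n * altSum x n := by
  -- The strict inequality survives scaling `x` by some `t > 1`, and the sum over words of length
  -- `n` is homogeneous of degree `n`.
  have hc : ContinuousAt (fun t : ℝ => ∑ i, t * x i / (1 + t * x i)) 1 := by
    refine tendsto_finsetSum _ fun i _ => ?_
    have : 1 + 1 * x i ≠ 0 := by have := hx i; positivity
    exact ContinuousAt.div (by fun_prop) (by fun_prop) this
  have h1 : ∀ᶠ t in 𝓝[>] (1 : ℝ), ∑ i, t * x i / (1 + t * x i) < 1 :=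
    (hc.eventually_lt continuousAt_const (by simpa using h)).filter_mono nhdsWithin_le_nhds
  obtain ⟨t, ht, ht1⟩ := (h1.and self_mem_nhdsWithin).exists
  refine ⟨t, ht1, ?_⟩
  have ht0 : (0 : ℝ) ≤ t := zero_le_one.trans (le_of_lt ht1)
  have := summable_altSum_of_lt_one (fun i => mul_nonneg ht0 (hx i)) ht
  refine this.congr fun n => ?_
  exact (altSum_smul t x n)

end AltSum

/-! ### Centred words, freeness, and orthogonality. -/

section Words

variable {ι A : Type*}

/-- The first index of a word. -/
def headIndex (l : List (ι × A)) : Option ι := l.head?.map Prod.fst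

@[simp] theorem headIndex_nil : headIndex ([] : List (ι × A)) = none := rfl

@[simp] theorem headIndex_cons (p : ι × A) (l : List (ι × A)) :
    headIndex (p :: l) = some p.1 := rfl

theorem isChain_append_cons_congr {l m : List (ι × A)} {i : ι} {a b : A} :
    (l ++ (i, a) :: m).IsChain (fun p q => p.1 ≠ q.1) ↔
      (l ++ (i, b) :: m).IsChain (fun p q => p.1 ≠ q.1) := by
  have h : ∀ l : List (ι × A), l.IsChain (fun p q => p.1 ≠ q.1) ↔
      (l.map Prod.fst).IsChain (· ≠ ·) := fun l => by rw [List.isChain_map]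
  rw [h, h]; simp

/-- The adjoint of a word. -/
def starWord [Star A] (l : List (ι × A)) : List (ι × A) := (l.map fun p => (p.1, star p.2)).reverse

theorem starWord_prod [Ring A] [StarRing A] (l : List (ι × A)) :
    ((starWord l).map Prod.snd).prod = star (l.map Prod.snd).prod := by
  induction l with
  | nil => simp [starWord]
  | cons p l ih => simp [starWord] at ih ⊢; simp [ih]

end Words

section Free

variable {ι A : Type*} [Ring A] [Algebra ℂ A] {φ : A →ₗ[ℂ] ℂ} {B : ι → Subalgebra ℂ A}

/-- A word `a₁ ⋯ aₙ` of centred elements of the algebras `B i`, neighbouring indices different. -/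
def IsCenteredWord (φ : A →ₗ[ℂ] ℂ) (B : ι → Subalgebra ℂ A) (l : List (ι × A)) : Prop :=
  (∀ p ∈ l, p.2 ∈ B p.1 ∧ φ p.2 = 0) ∧ l.IsChain (fun p q => p.1 ≠ q.1)

theorem isCenteredWord_nil : IsCenteredWord φ B [] := by simp [IsCenteredWord]

theorem isCenteredWord_cons {i : ι} {a : A} {l : List (ι × A)} :
    IsCenteredWord φ B ((i, a) :: l) ↔
      (a ∈ B i ∧ φ a = 0) ∧ headIndex l ≠ some i ∧ IsCenteredWord φ B l := by
  simp only [IsCenteredWord, List.forall_mem_cons, List.isChain_cons]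
  constructor
  · rintro ⟨⟨h1, h2⟩, h3, h4⟩
    refine ⟨h1, fun h => ?_, h2, h4⟩
    rcases l with _ | ⟨p, l⟩
    · simp at h
    · exact h3 p (by simp) (by simpa using h.symm)
  · rintro ⟨h1, h2, h3, h4⟩
    refine ⟨⟨h1, h3⟩, fun p hp h => h2 ?_, h4⟩
    rcases l with _ | ⟨q, l⟩
    · simp at hp
    · simp at hp; simp [hp, h]

theorem FreeSubalgebras.prod_eq_zero (h : FreeSubalgebras φ B) {l : List (ι × A)}
    (hl : IsCenteredWord φ B l) (h0 : l ≠ []) : φ (l.map Prod.snd).prod = 0 :=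
  h l h0 hl.1 hl.2

theorem FreeSubalgebras.list_map_prod_eq_zero (h : FreeSubalgebras φ B) {S : ι → A}
    (hS : ∀ i, S i ∈ B i) (hφ : ∀ i, φ (S i) = 0) {w : List ι} (hw : IsAlternating w)
    (h0 : w ≠ []) : φ (w.map S).prod = 0 := by
  have := h (w.map fun i => (i, S i)) (by simpa using h0) (by simpa using fun i _ => ⟨hS i, hφ i⟩)
    (by rw [List.isChain_map]; exact hw)
  simpa [Function.comp_def] using this

theorem FreeSubalgebras.altSum_eq_zero [Finite ι] (h : FreeSubalgebras φ B) {S : ι → A}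
    (hS : ∀ i, S i ∈ B i) (hφ : ∀ i, φ (S i) = 0) (n : ℕ) : φ (altSum S (n + 1)) = 0 := by
  rw [altSum, map_sum]
  refine Finset.sum_eq_zero fun w hw => ?_
  rw [mem_alternatingWords] at hw
  exact h.list_map_prod_eq_zero hS hφ hw.2 (by rintro rfl; simp at hw)

end Free

section Closure

variable {ι A : Type*} [NormedRing A] [NormedAlgebra ℂ A]

/-- Approximants from `B` are recentred by `b ↦ b - φ b • 1`, a continuous map that fixes `a`. -/
theorem mem_closure_centered {φ : A →L[ℂ] ℂ} (h1 : φ 1 = 1) {B : Subalgebra ℂ A} {a : A}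
    (ha : a ∈ B.topologicalClosure) (hφ : φ a = 0) : a ∈ closure {b : A | b ∈ B ∧ φ b = 0} := by
  have hc : Continuous fun b : A => b - φ b • (1 : A) := by fun_prop
  have := map_mem_closure (t := {b : A | b ∈ B ∧ φ b = 0}) hc
    (show a ∈ closure (B : Set A) from ha) fun b hb =>
    ⟨B.sub_mem hb (B.smul_mem B.one_mem _), by simp [h1]⟩
  simpa [hφ] using this

/-- Freeness passes to the closures of the subalgebras. -/
theorem FreeSubalgebras.closure {φ : A →L[ℂ] ℂ} (h1 : φ 1 = 1) {B : ι → Subalgebra ℂ A}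
    (h : FreeSubalgebras φ.toLinearMap B) :
    FreeSubalgebras φ.toLinearMap fun i => (B i).topologicalClosure := by
  -- The letters of `l` are in the algebras, those of `m` only in the closures. By continuity in a
  -- single letter, the letters of `m` move to `l` one at a time.
  have key : ∀ m l : List (ι × A), l ++ m ≠ [] →
      (∀ p ∈ l, p.2 ∈ B p.1 ∧ φ p.2 = 0) →
      (∀ p ∈ m, p.2 ∈ (B p.1).topologicalClosure ∧ φ p.2 = 0) →
      (l ++ m).IsChain (fun p q => p.1 ≠ q.1) →
      φ ((l.map Prod.snd).prod * (m.map Prod.snd).prod) = 0 := by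
    intro m
    induction m with
    | nil =>
      intro l h0 hl _ hc
      simpa using h l (by simpa using h0) hl (by simpa using hc)
    | cons p m ih =>
      obtain ⟨i, a⟩ := p
      intro l _ hl hm hc
      have ha := mem_closure_centered h1 (hm (i, a) (by simp)).1 (hm (i, a) (by simp)).2
      have hcont : Continuous fun b : A =>
          φ ((l.map Prod.snd).prod * (b * (m.map Prod.snd).prod)) := by fun_prop
      have hz := map_mem_closure (t := {0}) hcont ha fun b hb => by
        have := ih (l ++ [(i, b)]) (by simp) (by
          intro p hp
          rcases List.mem_append.1 hp with hp | hp
          · exact hl p hp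
          · rw [List.mem_singleton.1 hp]; exact hb) (fun p hp => hm p (by simp [hp])) (by
          rw [List.append_assoc]
          exact isChain_append_cons_congr.1 hc)
        simpa [mul_assoc] using this
      simpa using hz
  intro l h0 hl hc
  simpa using key l [] (by simpa using h0) (by simp) hl (by simpa using hc)

end Closure

section Star

variable {ι A : Type*} [Ring A] [StarRing A] [Algebra ℂ A] {φ : A →ₗ[ℂ] ℂ}
  {B : ι → Subalgebra ℂ A}

theorem isCenteredWord_starWord (hB : ∀ i, ∀ a ∈ B i, star a ∈ B i)
    (hφ : ∀ a, φ (star a) = star (φ a)) {l : List (ι × A)} (hl : IsCenteredWord φ B l) :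
    IsCenteredWord φ B (starWord l) := by
  refine ⟨fun p hp => ?_, ?_⟩
  · simp only [starWord, List.mem_reverse, List.mem_map] at hp
    obtain ⟨q, hq, rfl⟩ := hp
    exact ⟨hB _ _ (hl.1 q hq).1, by simp [hφ, (hl.1 q hq).2]⟩
  · rw [starWord, List.isChain_reverse, List.isChain_map]
    exact hl.2.imp fun _ _ h => h.symm

theorem isCenteredWord_starWord_append (hB : ∀ i, ∀ a ∈ B i, star a ∈ B i)
    (hφ : ∀ a, φ (star a) = star (φ a)) {l m : List (ι × A)} (hl : IsCenteredWord φ B l)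
    (hm : IsCenteredWord φ B m) (h : headIndex l = none ∨ headIndex l ≠ headIndex m) :
    IsCenteredWord φ B (starWord l ++ m) := by
  have hl' := isCenteredWord_starWord hB hφ hl
  refine ⟨fun p hp => ?_, ?_⟩
  · rcases List.mem_append.1 hp with hp | hp
    exacts [hl'.1 p hp, hm.1 p hp]
  · rw [List.isChain_append]
    refine ⟨hl'.2, hm.2, fun p hp q hq e => ?_⟩
    rcases l with _ | ⟨r, l⟩
    · simp [starWord] at hp
    · rcases m with _ | ⟨s, m⟩
      · simp at hq
      · simp [starWord] at hp hq h
        subst hp hq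
        exact h e

/-- Centred words beginning with different letters are orthogonal. -/
theorem FreeSubalgebras.star_mul_eq_zero (h : FreeSubalgebras φ B)
    (hB : ∀ i, ∀ a ∈ B i, star a ∈ B i) (hφ : ∀ a, φ (star a) = star (φ a))
    {l m : List (ι × A)} (hl : IsCenteredWord φ B l) (hm : IsCenteredWord φ B m)
    (hlm : headIndex l ≠ headIndex m) :
    φ (star (l.map Prod.snd).prod * (m.map Prod.snd).prod) = 0 := by
  rw [← starWord_prod, ← List.prod_append, ← List.map_append]
  refine h.prod_eq_zero (isCenteredWord_starWord_append hB hφ hl hm (Or.inr hlm)) fun h0 => ?_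
  simp [starWord] at h0
  simp [h0] at hlm

/-- A letter in the middle of two words that do not begin with its index splits off. -/
theorem FreeSubalgebras.star_mul_mul (h : FreeSubalgebras φ B) (h1 : φ 1 = 1)
    (hB : ∀ i, ∀ a ∈ B i, star a ∈ B i) (hφ : ∀ a, φ (star a) = star (φ a))
    {l m : List (ι × A)} (hl : IsCenteredWord φ B l) (hm : IsCenteredWord φ B m) {i : ι} {a : A}
    (ha : a ∈ B i) (hli : headIndex l ≠ some i) (hmi : headIndex m ≠ some i) :
    φ (star (l.map Prod.snd).prod * a * (m.map Prod.snd).prod) =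
      φ a * φ (star (l.map Prod.snd).prod * (m.map Prod.snd).prod) := by
  -- With the centred part `b` in the middle the product is a single centred alternating word, which
  -- `φ` kills; only the scalar part of `a` survives.
  set b : A := a - φ a • (1 : A) with hb
  have hbB : b ∈ B i := (B i).sub_mem ha ((B i).smul_mem (B i).one_mem _)
  have hφb : φ b = 0 := by simp [hb, h1]
  have hw : IsCenteredWord φ B (starWord l ++ (i, b) :: m) :=
    isCenteredWord_starWord_append hB hφ hl
      (isCenteredWord_cons.2 ⟨⟨hbB, hφb⟩, hmi, hm⟩) (Or.inr (by simpa using hli))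
  have h0 := h.prod_eq_zero hw (by simp)
  rw [List.map_append, List.prod_append, starWord_prod, List.map_cons, List.prod_cons] at h0
  have ha' : a = b + φ a • (1 : A) := by simp [hb]
  conv_lhs => rw [ha']
  rw [mul_add, add_mul, map_add, mul_assoc, h0]
  simp

open scoped Classical in
/-- Alternating words in the `Sᵢ` are orthogonal. -/
theorem FreeSubalgebras.star_word_mul_word (h : FreeSubalgebras φ B) (h1 : φ 1 = 1)
    (hB : ∀ i, ∀ a ∈ B i, star a ∈ B i) (hφ : ∀ a, φ (star a) = star (φ a))
    {S : ι → A} (hS : ∀ i, S i ∈ B i) (hS0 : ∀ i, φ (S i) = 0) {v w : List ι}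
    (hv : IsAlternating v) (hw : IsAlternating w) :
    φ (star (v.map S).prod * (w.map S).prod) =
      if v = w then (w.map fun i => φ (star (S i) * S i)).prod else 0 := by
  have hc : ∀ {w : List ι}, IsAlternating w →
      IsCenteredWord φ B (w.map fun i => (i, S i)) := fun {w} hw =>
    ⟨by simpa using fun i _ => ⟨hS i, hS0 i⟩, by rw [List.isChain_map]; exact hw⟩
  have hp : ∀ w : List ι, ((w.map fun i => (i, S i)).map Prod.snd) = w.map S := fun w => by simp
  have hh : ∀ w : List ι, headIndex (w.map fun i => (i, S i)) = w.head? := fun w => by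
    cases w <;> simp
  have hdiff : ∀ {v w : List ι}, IsAlternating v → IsAlternating w → v.head? ≠ w.head? →
      φ (star (v.map S).prod * (w.map S).prod) = 0 := fun {v w} hv hw hvw => by
    have := h.star_mul_eq_zero hB hφ (hc hv) (hc hw) (by rwa [hh, hh])
    rwa [hp, hp] at this
  -- Different first letters give a centred alternating product. Equal ones meet as `star (S i) * S
  -- i`, which splits off as a scalar and leaves the shorter words.
  induction v generalizing w with
  | nil =>
    rcases w with _ | ⟨j, w⟩
    · simp [h1]
    · rw [if_neg (by simp)]; exact hdiff hv hw (by simp)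
  | cons i v ih =>
    rcases w with _ | ⟨j, w⟩
    · rw [if_neg (by simp)]; exact hdiff hv hw (by simp)
    · by_cases hij : i = j
      · subst hij
        rw [isAlternating_cons] at hv hw
        have := h.star_mul_mul h1 hB hφ (hc hv.2) (hc hw.2)
          ((B i).mul_mem (hB i _ (hS i)) (hS i)) (by rw [hh]; exact hv.1) (by rw [hh]; exact hw.1)
        rw [hp, hp, ih hv.2 hw.2] at this
        simp only [List.map_cons, List.prod_cons, star_mul, List.cons.injEq, true_and]
        rw [mul_assoc, ← mul_assoc (star (S i)), ← mul_assoc, this]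
        split_ifs <;> simp
      · rw [if_neg (by simp [hij])]
        exact hdiff hv hw (by simpa using hij)

end Star

/-! ### The vectors of alternating words in `L²(φ)`. -/

section L2

variable {A : Type*} [CStarAlgebra A] [PartialOrder A] [StarOrderedRing A] (φ : A →ₚ[ℂ] ℂ)

/-- `toL2` as a linear map. -/
noncomputable def toL2Linear : A →ₗ[ℂ] φ.GNS where
  toFun := toL2 φ
  map_add' a b := by simp [toL2, UniformSpace.Completion.coe_add]
  map_smul' c a := by simp [toL2, UniformSpace.Completion.coe_smul]

theorem toL2Linear_apply (a : A) : toL2Linear φ a = toL2 φ a := rfl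

theorem toL2_sum {κ : Type*} (s : Finset κ) (a : κ → A) :
    toL2 φ (∑ k ∈ s, a k) = ∑ k ∈ s, toL2 φ (a k) :=
  map_sum (toL2Linear φ) a s

theorem inner_toL2 (a b : A) : inner ℂ (toL2 φ a) (toL2 φ b) = φ (star a * b) := by
  simp [toL2, PositiveLinearMap.preGNS_inner_def]

theorem gns_toL2 (a b : A) : φ.gnsStarAlgHom a (toL2 φ b) = toL2 φ (a * b) := by
  simp [toL2]

theorem toL2_eq (a : A) : toL2 φ a = φ.gnsStarAlgHom a (toL2 φ 1) := by
  rw [gns_toL2, mul_one]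

theorem denseRange_toL2 : DenseRange (toL2 φ) := by
  refine UniformSpace.Completion.denseRange_coe.comp ?_ (UniformSpace.Completion.continuous_coe _)
  exact (φ.toPreGNS.surjective).denseRange

theorem continuous_toL2 : Continuous (toL2 φ) := by
  have h : Continuous φ.gnsStarAlgHom :=
    AddMonoidHomClass.continuous_of_bound φ.gnsStarAlgHom 1 fun a => by
      simpa using NonUnitalStarAlgHom.norm_apply_le φ.gnsStarAlgHom a
  have : toL2 φ = fun a => φ.gnsStarAlgHom a (toL2 φ 1) := funext fun a => toL2_eq φ a
  rw [this]
  exact (ContinuousLinearMap.apply ℂ φ.GNS (toL2 φ 1)).continuous.comp h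

theorem map_star_eq (a : A) : φ (star a) = star (φ a) := map_star φ a

theorem apply_star_mul_self (a : A) : φ (star a * a) = ((l2Norm φ a ^ 2 : ℝ) : ℂ) := by
  rw [← norm_toL2, ← inner_toL2, inner_self_eq_norm_sq_to_K]
  simp

/-- `φ` is the vector functional of `toL2 φ 1` in the contractive GNS representation. -/
theorem continuous_of_positive : Continuous φ := by
  have : (φ : A → ℂ) = fun a => inner ℂ (toL2 φ 1) (toL2 φ a) := by
    ext a; rw [inner_toL2]; simp
  rw [this]
  exact continuous_const.inner (continuous_toL2 φ)

/-- A positive functional as a continuous linear map. -/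
noncomputable def toCLM : A →L[ℂ] ℂ := ⟨φ.toLinearMap, continuous_of_positive φ⟩

end L2

section Family

/-- Centred elements `Sᵢ` of free `*`-subalgebras `Bᵢ`. -/
structure IsCenteredFreeFamily {ι A : Type*} [Ring A] [StarRing A] [Algebra ℂ A] (φ : A →ₗ[ℂ] ℂ)
    (B : ι → Subalgebra ℂ A) (S : ι → A) : Prop where
  map_one : φ 1 = 1
  map_star : ∀ a, φ (star a) = star (φ a)
  star_mem : ∀ i, ∀ a ∈ B i, star a ∈ B i
  free : FreeSubalgebras φ B
  mem : ∀ i, S i ∈ B i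
  centered : ∀ i, φ (S i) = 0

theorem IsCenteredFreeFamily.star {ι A : Type*} [Ring A] [StarRing A] [Algebra ℂ A]
    {φ : A →ₗ[ℂ] ℂ} {B : ι → Subalgebra ℂ A} {S : ι → A} (h : IsCenteredFreeFamily φ B S) :
    IsCenteredFreeFamily φ B fun i => star (S i) where
  map_one := h.map_one
  map_star := h.map_star
  star_mem := h.star_mem
  free := h.free
  mem i := h.star_mem i _ (h.mem i)
  centered i := by rw [h.map_star, h.centered, star_zero]

end Family

section Orthogonal

/-- Using the lines spanned by the vectors avoids normalisation, so zero vectors are allowed. -/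
theorem orthogonalFamily_span {H : Type*} [NormedAddCommGroup H] [InnerProductSpace ℂ H]
    {v : ℕ → H} (hv : Pairwise fun m n => inner ℂ (v m) (v n) = 0) :
    OrthogonalFamily ℂ (fun n => Submodule.span ℂ {v n})
      fun n => (Submodule.span ℂ {v n}).subtypeₗᵢ := by
  intro m n hmn x y
  obtain ⟨a, ha⟩ := Submodule.mem_span_singleton.1 x.2
  obtain ⟨b, hb⟩ := Submodule.mem_span_singleton.1 y.2
  rw [Submodule.coe_subtypeₗᵢ, Submodule.coe_subtypeₗᵢ, Submodule.subtype_apply,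
    Submodule.subtype_apply, ← ha, ← hb, inner_smul_left, inner_smul_right, hv hmn]
  simp

theorem summable_iff_of_orthogonal {H : Type*} [NormedAddCommGroup H] [InnerProductSpace ℂ H]
    [CompleteSpace H] {v : ℕ → H} (hv : Pairwise fun m n => inner ℂ (v m) (v n) = 0) :
    Summable v ↔ Summable fun n => ‖v n‖ ^ 2 :=
  (orthogonalFamily_span hv).summable_iff_norm_sq_summable
    fun n => ⟨v n, Submodule.mem_span_singleton_self _⟩

/-- Pairing `s` with `v m` leaves only `‖v m‖²`; pairing the series with `s` then sums these. -/
theorem hasSum_norm_sq_of_orthogonal {H : Type*} [NormedAddCommGroup H] [InnerProductSpace ℂ H]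
    {v : ℕ → H} (hv : Pairwise fun m n => inner ℂ (v m) (v n) = 0) {s : H} (hs : HasSum v s) :
    HasSum (fun n => ‖v n‖ ^ 2) (‖s‖ ^ 2) := by
  have h1 : ∀ m, inner ℂ s (v m) = ((‖v m‖ ^ 2 : ℝ) : ℂ) := fun m => by
    have h2 : HasSum (fun n => inner ℂ (v m) (v n)) (inner ℂ (v m) s) :=
      hs.mapL (innerSL ℂ (v m))
    have h3 := h2.unique (hasSum_single m fun n hn => hv hn.symm)
    rw [← inner_conj_symm, h3, inner_self_eq_norm_sq_to_K]
    simp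
  have h2 : HasSum (fun n => inner ℂ s (v n)) (inner ℂ s s) := hs.mapL (innerSL ℂ s)
  simp only [h1, inner_self_eq_norm_sq_to_K] at h2
  rw [← Complex.hasSum_ofReal]
  simpa using h2

end Orthogonal

section L2

variable {ι : Type*} {A : Type*} [CStarAlgebra A] [PartialOrder A] [StarOrderedRing A]
  {φ : A →ₚ[ℂ] ℂ} {B : ι → Subalgebra ℂ A} {S : ι → A}

-- By orthogonality only common words contribute. Arbitrary finite sets are allowed in order to
-- treat `altSum` and `altSumFrom` together.
open scoped Classical in
theorem IsCenteredFreeFamily.inner_sum_words (h : IsCenteredFreeFamily φ.toLinearMap B S)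
    {F G : Finset (List ι)} (hF : ∀ w ∈ F, IsAlternating w) (hG : ∀ w ∈ G, IsAlternating w) :
    inner ℂ (toL2 φ (∑ w ∈ F, (w.map S).prod)) (toL2 φ (∑ w ∈ G, (w.map S).prod)) =
      ((∑ w ∈ F ∩ G, (w.map fun i => l2Norm φ (S i) ^ 2).prod : ℝ) : ℂ) := by
  rw [inner_toL2, star_sum, Finset.sum_mul_sum, map_sum, ← Finset.filter_mem_eq_inter]
  push_cast
  rw [Finset.sum_filter]
  refine Finset.sum_congr rfl fun v hv => ?_
  rw [map_sum]
  have : ∀ w ∈ G, φ (Star.star (v.map S).prod * (w.map S).prod) =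
      if v = w then ((w.map fun i => ((l2Norm φ (S i) ^ 2 : ℝ) : ℂ)).prod) else 0 := fun w hw => by
    have := h.free.star_word_mul_word h.map_one h.star_mem h.map_star h.mem h.centered
      (hF v hv) (hG w hw)
    simp only [← apply_star_mul_self]
    exact this
  rw [Finset.sum_congr rfl this, Finset.sum_ite_eq]
  split_ifs
  · have := map_list_prod Complex.ofRealHom (v.map fun i => l2Norm φ (S i) ^ 2)
    simpa [Function.comp_def] using this.symm
  · rfl

theorem IsCenteredFreeFamily.norm_sum_words (h : IsCenteredFreeFamily φ.toLinearMap B S)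
    {F : Finset (List ι)} (hF : ∀ w ∈ F, IsAlternating w) :
    ‖toL2 φ (∑ w ∈ F, (w.map S).prod)‖ ^ 2 =
      ∑ w ∈ F, (w.map fun i => l2Norm φ (S i) ^ 2).prod := by
  classical
  have := h.inner_sum_words hF hF
  rw [inner_self_eq_norm_sq_to_K, Finset.inter_self] at this
  exact Complex.ofReal_injective (by simpa using this)

variable [Fintype ι]

theorem IsCenteredFreeFamily.inner_altSum (h : IsCenteredFreeFamily φ.toLinearMap B S)
    {m n : ℕ} (hmn : m ≠ n) :
    inner ℂ (toL2 φ (altSum S m)) (toL2 φ (altSum S n)) = 0 := by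
  classical
  rw [altSum, altSum, h.inner_sum_words (fun w hw => (mem_alternatingWords.1 hw).2)
    (fun w hw => (mem_alternatingWords.1 hw).2), Finset.disjoint_iff_inter_eq_empty.1]
  · simp
  · rw [Finset.disjoint_left]
    intro w hw hw'
    exact hmn ((mem_alternatingWords.1 hw).1.symm.trans (mem_alternatingWords.1 hw').1)

theorem IsCenteredFreeFamily.norm_altSum (h : IsCenteredFreeFamily φ.toLinearMap B S) (n : ℕ) :
    ‖toL2 φ (altSum S n)‖ ^ 2 = altSum (fun i => l2Norm φ (S i) ^ 2) n :=
  h.norm_sum_words fun _ hw => (mem_alternatingWords.1 hw).2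

theorem IsCenteredFreeFamily.norm_altSumFrom (h : IsCenteredFreeFamily φ.toLinearMap B S) (n : ℕ)
    (i : ι) :
    ‖toL2 φ (altSumFrom S n i)‖ ^ 2 = altSumFrom (fun i => l2Norm φ (S i) ^ 2) n i :=
  h.norm_sum_words fun _ hw => (mem_alternatingWordsFrom.1 hw).1.2

theorem IsCenteredFreeFamily.summable_toL2_iff (h : IsCenteredFreeFamily φ.toLinearMap B S) :
    Summable (fun n => toL2 φ (altSum S (n + 1))) ↔
      Summable fun n => altSum (fun i => l2Norm φ (S i) ^ 2) (n + 1) := by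
  simp only [← h.norm_altSum]
  exact summable_iff_of_orthogonal fun m n hmn => h.inner_altSum (by simpa using hmn)

/-- The resolvent formula in `L²(φ)`. -/
theorem IsCenteredFreeFamily.gns_pencil (h : IsCenteredFreeFamily φ.toLinearMap B S) {V : ι → A}
    (hV : ∀ i, V i * (1 + S i) = 1) {s : φ.GNS}
    (hs : HasSum (fun n => toL2 φ (altSum S (n + 1))) s) :
    φ.gnsStarAlgHom (1 - ∑ i, (1 - V i)) (toL2 φ 1 + s) = toL2 φ 1 := by
  have h0 : HasSum (fun n => toL2 φ (altSum S n)) (toL2 φ 1 + s) := by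
    rw [← hasSum_nat_add_iff' 1]; simpa using hs
  have h1 := ((φ.gnsStarAlgHom (1 - ∑ i, (1 - V i))).continuous.tendsto _).comp
    (h0.tendsto_sum_nat.comp (tendsto_add_atTop_nat 1))
  have hsum := h.summable_toL2_iff.1 hs.summable
  have h2 : Tendsto (fun N => toL2 φ 1 -
      ∑ i, φ.gnsStarAlgHom (V i) (toL2 φ (altSumFrom S (N + 1) i))) atTop (𝓝 (toL2 φ 1)) := by
    -- The squared norm of the error is part of the scalar sum over words of the same length, which
    -- tends to zero.
    have h3 : ∀ i, Tendsto (fun N => toL2 φ (altSumFrom S (N + 1) i)) atTop (𝓝 0) := fun i => by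
      rw [tendsto_zero_iff_norm_tendsto_zero]
      have h4 : Tendsto (fun N => ‖toL2 φ (altSumFrom S (N + 1) i)‖ ^ 2) atTop (𝓝 0) := by
        simp only [h.norm_altSumFrom]
        exact squeeze_zero (fun n => altSumFrom_nonneg (fun _ => sq_nonneg _) _ _)
          (fun n => altSumFrom_le (fun _ => sq_nonneg _) _ _) hsum.tendsto_atTop_zero
      simpa using h4.sqrt
    have h5 : ∀ i, Tendsto (fun N => φ.gnsStarAlgHom (V i) (toL2 φ (altSumFrom S (N + 1) i)))
        atTop (𝓝 0) := fun i => by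
      rw [← map_zero (φ.gnsStarAlgHom (V i))]
      exact ((φ.gnsStarAlgHom (V i)).continuous.tendsto 0).comp (h3 i)
    simpa using (tendsto_finsetSum Finset.univ fun i _ => h5 i).const_sub (toL2 φ 1)
  refine tendsto_nhds_unique (h1.congr fun N => ?_) h2
  have key := congrArg (toL2Linear φ) (mul_sum_altSum S V hV N)
  simp only [map_sub, map_sum] at key
  simp only [toL2Linear_apply, ← gns_toL2] at key
  rw [← key, toL2_sum]
  rfl

end L2

/-! ### From the algebraic identity to the resolvent of the sum. -/

section Pencil

variable {ι : Type*} [Fintype ι] {A : Type*} [Ring A]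

/-- `hF` is separate because convergence of the series controls all words of a length together, not
those with a given first letter. -/
theorem mul_one_add_eq_one [TopologicalSpace A] [IsTopologicalRing A] [T2Space A] {S V : ι → A}
    (hV : ∀ i, V i * (1 + S i) = 1) {s : A} (hs : HasSum (fun n => altSum S (n + 1)) s)
    (hF : ∀ i, Tendsto (fun n => altSumFrom S (n + 1) i) atTop (𝓝 0)) :
    (1 - ∑ i, (1 - V i)) * (1 + s) = 1 := by
  have h0 : HasSum (fun n => altSum S n) (1 + s) := by
    rw [← hasSum_nat_add_iff' 1]; simpa using hs
  have h1 := (h0.tendsto_sum_nat.comp (tendsto_add_atTop_nat 1)).const_mul (1 - ∑ i, (1 - V i))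
  have h2 : Tendsto (fun N => 1 - ∑ i, V i * altSumFrom S (N + 1) i) atTop (𝓝 1) := by
    simpa using (tendsto_finsetSum Finset.univ fun i _ => (hF i).const_mul (V i)).const_sub 1
  exact tendsto_nhds_unique (h1.congr fun N => mul_sum_altSum S V hV N) h2

/-- The preceding result in the opposite ring, where the error consists of words with a given last
letter. -/
theorem one_add_mul_eq_one [TopologicalSpace A] [IsTopologicalRing A] [T2Space A] {S V : ι → A}
    (hV : ∀ i, (1 + S i) * V i = 1) {s : A} (hs : HasSum (fun n => altSum S (n + 1)) s)
    (hF : ∀ i, Tendsto (fun n => altSumFrom (fun i => MulOpposite.op (S i)) (n + 1) i)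
      atTop (𝓝 0)) :
    (1 + s) * (1 - ∑ i, (1 - V i)) = 1 := by
  apply MulOpposite.op_injective
  have := mul_one_add_eq_one (S := fun i => MulOpposite.op (S i))
    (V := fun i => MulOpposite.op (V i)) (s := MulOpposite.op s)
    (fun i => by rw [← MulOpposite.op_one, ← MulOpposite.op_add, ← MulOpposite.op_mul, hV])
    (by simp only [altSum_op]; exact hs.op) hF
  rw [MulOpposite.op_mul]
  simpa using this

variable [Algebra ℂ A]

theorem smul_pencil_mul {a s : A} {k z : ℂ} (hk : k ∈ resolventSet ℂ a)
    (h : resolvent a k = z • (1 + s)) : z • (algebraMap ℂ A k - a) * (1 + s) = 1 := by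
  rw [smul_mul_assoc, ← mul_smul_comm, ← h]
  exact Ring.mul_inverse_cancel _ hk

theorem mul_smul_pencil {a s : A} {k z : ℂ} (hk : k ∈ resolventSet ℂ a)
    (h : resolvent a k = z • (1 + s)) : (1 + s) * z • (algebraMap ℂ A k - a) = 1 := by
  rw [mul_smul_comm, ← smul_mul_assoc, ← h]
  exact Ring.inverse_mul_cancel _ hk

/-- The point where the addition of `R`-transforms enters: `1 - z (K_i - T_i) = z T_i - r_i` is
additive in `i`. -/
theorem one_sub_sum_pencil {T : ι → A} {r : ι → ℂ} {z : ℂ} (hz : z ≠ 0) :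
    1 - ∑ i, (1 - z • (algebraMap ℂ A ((1 + r i) / z) - T i)) =
      z • (algebraMap ℂ A ((1 + ∑ i, r i) / z) - ∑ i, T i) := by
  have h : ∀ c : ℂ, z • algebraMap ℂ A ((1 + c) / z) = 1 + algebraMap ℂ A c := fun c => by
    rw [Algebra.smul_def, ← map_mul, mul_div_cancel₀ _ hz, map_add, map_one]
  have h2 : ∀ i, 1 - z • (algebraMap ℂ A ((1 + r i) / z) - T i) =
      z • T i - algebraMap ℂ A (r i) := fun i => by rw [smul_sub, h]; abel
  rw [smul_sub, h, Finset.sum_congr rfl fun i _ => h2 i, Finset.sum_sub_distrib, Finset.smul_sum,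
    map_sum]
  abel

theorem resolvent_of_smul_pencil {a s : A} {k z : ℂ}
    (h1 : z • (algebraMap ℂ A k - a) * (1 + s) = 1)
    (h2 : (1 + s) * z • (algebraMap ℂ A k - a) = 1) :
    k ∈ resolventSet ℂ a ∧ resolvent a k = z • (1 + s) := by
  have h1' : (algebraMap ℂ A k - a) * (z • (1 + s)) = 1 := by
    rw [mul_smul_comm, ← smul_mul_assoc, h1]
  have h2' : z • (1 + s) * (algebraMap ℂ A k - a) = 1 := by
    rw [smul_mul_assoc, ← mul_smul_comm, h2]
  refine ⟨⟨⟨_, _, h1', h2'⟩, rfl⟩, ?_⟩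
  exact Ring.inverse_unit ⟨_, _, h1', h2'⟩

theorem apply_eq_zero_of_cauchyTransform {φ : A →ₗ[ℂ] ℂ} (hφ : φ 1 = 1) {a s : A} {k z : ℂ}
    (hz : z ≠ 0) (hG : cauchyTransform φ a k = z) (h : resolvent a k = z • (1 + s)) :
    φ s = 0 := by
  rw [cauchyTransform, h, map_smul, map_add, hφ, smul_eq_mul] at hG
  have : z * φ s = 0 := by linear_combination hG
  exact (mul_eq_zero.1 this).resolve_left hz

end Pencil

/-! ### Unconditional sums over words, sorted by length. -/

section Words

variable {ι : Type*} {A : Type*}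

/-- Reversal of alternating words. -/
def reverseWord (ι : Type*) : {w : List ι // w ≠ [] ∧ IsAlternating w} ≃
    {w : List ι // w ≠ [] ∧ IsAlternating w} where
  toFun w := ⟨w.1.reverse, by simpa using w.2.1, by
    rw [IsAlternating, List.isChain_reverse]; exact w.2.2.imp fun _ _ h => h.symm⟩
  invFun w := ⟨w.1.reverse, by simpa using w.2.1, by
    rw [IsAlternating, List.isChain_reverse]; exact w.2.2.imp fun _ _ h => h.symm⟩
  left_inv w := by simp
  right_inv w := by simp

theorem summable_op_words [NormedRing A] {S : ι → A}
    (hs : Summable fun w : {w : List ι // w ≠ [] ∧ IsAlternating w} => (w.1.map S).prod) :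
    Summable fun w : {w : List ι // w ≠ [] ∧ IsAlternating w} =>
      (w.1.map fun i => MulOpposite.op (S i)).prod := by
  refine ((reverseWord ι).summable_iff.2 hs).op.congr fun w => ?_
  simp [reverseWord, MulOpposite.op_list_prod, Function.comp_def]

variable [Finite ι]

/-- A sum over all nonempty alternating words can be sorted by the length of the words. -/
theorem hasSum_alternatingWords [AddCommMonoid A] [TopologicalSpace A] [ContinuousAdd A]
    [RegularSpace A] {f : List ι → A} {s : A}
    (hs : HasSum (fun w : {w : List ι // w ≠ [] ∧ IsAlternating w} => f w.1) s) :
    HasSum (fun n => ∑ w ∈ alternatingWords ι (n + 1), f w) s := by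
  -- Length minus one: the words are nonempty, and the fibre over `n` is the set of words of length
  -- `n + 1`.
  let ℓ : {w : List ι // w ≠ [] ∧ IsAlternating w} → ℕ := fun w => w.1.length - 1
  rw [← (Equiv.sigmaFiberEquiv ℓ).hasSum_iff] at hs
  refine hs.sigma fun n => ?_
  let e : alternatingWords ι (n + 1) ≃ {w // ℓ w = n} :=
    { toFun := fun w => ⟨⟨w.1, by
        have := mem_alternatingWords.1 w.2
        exact ⟨fun h => by simp [h] at this, this.2⟩⟩, by
        simp [ℓ, (mem_alternatingWords.1 w.2).1]⟩
      invFun := fun w => ⟨w.1.1, mem_alternatingWords.2 ⟨by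
        have h1 := w.2
        have h2 := List.length_pos_iff.2 w.1.2.1
        simp only [ℓ] at h1
        omega, w.1.2.2⟩⟩
      left_inv := fun _ => rfl
      right_inv := fun _ => rfl }
  rw [← e.hasSum_iff]
  exact Finset.hasSum _ f

theorem hasSum_altSum_of_words [Semiring A] [TopologicalSpace A] [ContinuousAdd A]
    [RegularSpace A] {S : ι → A} {s : A}
    (hs : HasSum (fun w : {w : List ι // w ≠ [] ∧ IsAlternating w} => (w.1.map S).prod) s) :
    HasSum (fun n => altSum S (n + 1)) s :=
  hasSum_alternatingWords (f := fun w => (w.map S).prod) hs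

/-- Unconditional summability passes to the subfamily of words beginning with `i`, so its sums over
fixed length tend to zero. -/
theorem tendsto_altSumFrom_of_words [NormedRing A] [CompleteSpace A] {S : ι → A}
    (hs : Summable fun w : {w : List ι // w ≠ [] ∧ IsAlternating w} => (w.1.map S).prod) (i : ι) :
    Tendsto (fun n => altSumFrom S (n + 1) i) atTop (𝓝 0) := by
  classical
  obtain ⟨s, h⟩ := hs.indicator {w | w.1.head? = some i}
  have h' : HasSum (fun w : {w : List ι // w ≠ [] ∧ IsAlternating w} =>
      if w.1.head? = some i then (w.1.map S).prod else 0) s := by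
    refine h.congr_fun fun w => ?_
    rw [Set.indicator_apply]
    rfl
  have := (hasSum_alternatingWords
    (f := fun w => if w.head? = some i then (w.map S).prod else 0) h').summable.tendsto_atTop_zero
  refine this.congr fun n => ?_
  rw [altSumFrom, alternatingWordsFrom, ← Finset.sum_filter]

end Words

/-! ### Norm convergence and `L²`-convergence at a given point. -/

section CStar

variable {ι : Type*} {A : Type*} [CStarAlgebra A]

/-- Spectral permanence: an element of a closed `*`-subalgebra that is invertible in `A` is
invertible there. -/
theorem inverse_mem_elemental {a : A} {k : ℂ} (hk : k ∈ resolventSet ℂ a) :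
    resolvent a k ∈ StarAlgebra.elemental ℂ a := by
  have hcl : IsClosed (StarAlgebra.elemental ℂ a : Set A) := StarAlgebra.elemental.isClosed ℂ a
  set b : StarAlgebra.elemental ℂ a :=
    algebraMap ℂ _ k - ⟨a, StarAlgebra.elemental.self_mem ℂ a⟩ with hb
  have hu : IsUnit (b : A) := hk
  rw [StarSubalgebra.coe_isUnit (hS := hcl)] at hu
  have h1 : (b : A) * ((Ring.inverse b : StarAlgebra.elemental ℂ a) : A) = 1 := by
    exact congrArg Subtype.val (Ring.mul_inverse_cancel b hu)
  have h2 : resolvent a k = ((Ring.inverse b : StarAlgebra.elemental ℂ a) : A) := by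
    rw [resolvent, ← one_mul (Subtype.val _), ← Ring.inverse_mul_cancel _ hk, mul_assoc]
    exact (congrArg _ h1).trans (mul_one _) |>.symm
  rw [h2]
  exact Subtype.property _

variable [PartialOrder A] [StarOrderedRing A] {φ : A →ₚ[ℂ] ℂ}

theorem isCenteredFreeFamily_of_resolvent (hφ : φ 1 = 1) {T S : ι → A} {z : ℂ} {k : ι → ℂ}
    (hT : IsStarFree φ.toLinearMap T) (hz : z ≠ 0) (hk : ∀ i, k i ∈ resolventSet ℂ (T i))
    (hG : ∀ i, cauchyTransform φ.toLinearMap (T i) (k i) = z)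
    (hS : ∀ i, resolvent (T i) (k i) = z • (1 + S i)) :
    IsCenteredFreeFamily φ.toLinearMap
      (fun i => (StarAlgebra.elemental ℂ (T i)).toSubalgebra) S where
  map_one := hφ
  map_star := map_star_eq φ
  star_mem i a ha := star_mem (s := StarAlgebra.elemental ℂ (T i)) ha
  free := FreeSubalgebras.closure (φ := toCLM φ) hφ hT
  mem i := by
    have h1 : 1 + S i = z⁻¹ • resolvent (T i) (k i) := by rw [hS, inv_smul_smul₀ hz]
    have h2 : S i = z⁻¹ • resolvent (T i) (k i) - 1 := by rw [← h1]; abel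
    rw [h2]
    exact sub_mem (Subalgebra.smul_mem _ (inverse_mem_elemental (hk i)) _) (one_mem _)
  centered i := apply_eq_zero_of_cauchyTransform hφ hz (hG i) (hS i)

/-- Pythagoras: `φ (S i) = 0` makes `1` and `S i` orthogonal. It converts the norm formula into its
last form. -/
theorem l2Norm_resolvent {B : ι → Subalgebra ℂ A} {S : ι → A}
    (hfam : IsCenteredFreeFamily φ.toLinearMap B S) (z : ℂ) (i : ι) :
    l2Norm φ (z • (1 + S i)) ^ 2 = ‖z‖ ^ 2 * (1 + l2Norm φ (S i) ^ 2) := by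
  rw [← norm_toL2, ← norm_toL2, ← toL2Linear_apply, map_smul, map_add, norm_smul, mul_pow]
  simp only [toL2Linear_apply]
  have h1 : φ (1 : A) = 1 := hfam.map_one
  have h0 : φ (S i) = 0 := hfam.centered i
  have h2 : ‖toL2 φ 1‖ ^ 2 = 1 := by simp [norm_toL2, l2Norm, h1]
  rw [@norm_add_sq ℂ, inner_toL2, h2]
  simp [h0]

variable [Fintype ι]

/-- Shared by the two norm-convergent cases: `hl` makes `1 + s` a right inverse, `hr` a left
inverse, and `φ` kills the series term by term. -/
theorem resolvent_of_hasSum {B : ι → Subalgebra ℂ A} {T S : ι → A} {z : ℂ} {r : ι → ℂ}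
    (hfam : IsCenteredFreeFamily φ.toLinearMap B S) (hz : z ≠ 0)
    (hk : ∀ i, (1 + r i) / z ∈ resolventSet ℂ (T i))
    (hS : ∀ i, resolvent (T i) ((1 + r i) / z) = z • (1 + S i)) {s : A}
    (hs : HasSum (fun n => altSum S (n + 1)) s)
    (hl : ∀ i, Tendsto (fun n => altSumFrom S (n + 1) i) atTop (𝓝 0))
    (hr : ∀ i, Tendsto (fun n => altSumFrom (fun i => MulOpposite.op (S i)) (n + 1) i)
      atTop (𝓝 0)) :
    (1 + ∑ i, r i) / z ∈ resolventSet ℂ (∑ i, T i) ∧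
      resolvent (∑ i, T i) ((1 + ∑ i, r i) / z) = z • (1 + s) ∧
      φ (resolvent (∑ i, T i) ((1 + ∑ i, r i) / z)) = z := by
  have h1 := mul_one_add_eq_one (fun i => smul_pencil_mul (hk i) (hS i)) hs hl
  have h2 := one_add_mul_eq_one (fun i => mul_smul_pencil (hk i) (hS i)) hs hr
  rw [one_sub_sum_pencil hz] at h1 h2
  obtain ⟨h3, h4⟩ := resolvent_of_smul_pencil h1 h2
  refine ⟨h3, h4, ?_⟩
  have h5 : φ s = 0 := by
    have h6 : HasSum (fun n => φ (altSum S (n + 1))) (φ s) := hs.mapL (toCLM φ)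
    refine h6.unique ?_
    simp only [show ∀ n, φ (altSum S (n + 1)) = 0 from
      hfam.free.altSum_eq_zero hfam.mem hfam.centered]
    exact hasSum_zero
  have h7 : φ (1 : A) = 1 := hfam.map_one
  rw [h4, map_smul, map_add, h5, h7]
  simp

theorem l2_resolvent_formula {B : ι → Subalgebra ℂ A} {T S : ι → A} {z : ℂ} {r : ι → ℂ}
    (hfam : IsCenteredFreeFamily φ.toLinearMap B S) (hz : z ≠ 0)
    (hk : ∀ i, (1 + r i) / z ∈ resolventSet ℂ (T i))
    (hS : ∀ i, resolvent (T i) ((1 + r i) / z) = z • (1 + S i))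
    (hlt : ∑ i, l2Norm φ (S i) ^ 2 / (1 + l2Norm φ (S i) ^ 2) < 1) :
    ∃ (s ψ : φ.GNS) (σ : ℝ),
      HasSum (fun n : ℕ => toL2 φ (altSum S (n + 1))) s ∧
      ψ = z • (toL2 φ 1 + s) ∧
      φ.gnsStarAlgHom (algebraMap ℂ A ((1 + ∑ i, r i) / z) - ∑ i, T i) ψ = toL2 φ 1 ∧
      ((1 + ∑ i, r i) / z ∈ resolventSet ℂ (∑ i, T i) →
        toL2 φ (resolvent (∑ i, T i) ((1 + ∑ i, r i) / z)) = ψ) ∧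
      inner ℂ (toL2 φ 1) ψ = z ∧
      HasSum (fun n : ℕ => altSum (fun i => l2Norm φ (S i) ^ 2) (n + 1)) σ ∧
      ‖ψ‖ ^ 2 = ‖z‖ ^ 2 * (1 + σ) ∧
      ‖ψ‖ ^ 2 = ‖z‖ ^ 2 * (1 - ∑ i, l2Norm φ (S i) ^ 2 / (1 + l2Norm φ (S i) ^ 2))⁻¹ ∧
      ‖ψ‖ ^ 2 = ‖z‖ ^ 2 * (1 - ∑ i, (1 - ‖z‖ ^ 2 /
        l2Norm φ (resolvent (T i) ((1 + r i) / z)) ^ 2))⁻¹ := by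
  set x : ι → ℝ := fun i => l2Norm φ (S i) ^ 2 with hx
  have hx0 : ∀ i, 0 ≤ x i := fun i => sq_nonneg _
  have hsumx : Summable fun n => altSum x (n + 1) :=
    (summable_nat_add_iff 1).2 (summable_altSum_of_lt_one hx0 hlt)
  obtain ⟨s, hs⟩ := hfam.summable_toL2_iff.2 hsumx
  have hσ : HasSum (fun n => altSum x (n + 1)) (‖s‖ ^ 2) := by
    have := hasSum_norm_sq_of_orthogonal (fun m n hmn => hfam.inner_altSum (by simpa using hmn)) hs
    simpa only [hfam.norm_altSum] using this
  have h1 : φ (1 : A) = 1 := hfam.map_one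
  have hΩ : ‖toL2 φ 1‖ ^ 2 = 1 := by simp [norm_toL2, l2Norm, h1]
  have hΩs : inner ℂ (toL2 φ 1) s = 0 := by
    have h2 : HasSum (fun n => inner ℂ (toL2 φ 1) (toL2 φ (altSum S (n + 1))))
      (inner ℂ (toL2 φ 1) s) := hs.mapL (innerSL ℂ (toL2 φ 1))
    refine h2.unique ?_
    have h3 : ∀ n, inner ℂ (toL2 φ 1) (toL2 φ (altSum S (n + 1))) = 0 := fun n => by
      rw [← altSum_zero S]; exact hfam.inner_altSum (by simp)
    simp only [h3]
    exact hasSum_zero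
  have hnorm : ‖z • (toL2 φ 1 + s)‖ ^ 2 = ‖z‖ ^ 2 * (1 + ‖s‖ ^ 2) := by
    rw [norm_smul, mul_pow, @norm_add_sq ℂ, hΩs, hΩ]
    simp
  have hform : 1 + ‖s‖ ^ 2 = (1 - ∑ i, x i / (1 + x i))⁻¹ :=
    eq_inv_of_mul_eq_one_right (hasSum_altSum_mul hx0 hσ)
  have hpsi : φ.gnsStarAlgHom (algebraMap ℂ A ((1 + ∑ i, r i) / z) - ∑ i, T i)
      (z • (toL2 φ 1 + s)) = toL2 φ 1 := by
    have := hfam.gns_pencil (fun i => smul_pencil_mul (hk i) (hS i)) hs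
    rw [one_sub_sum_pencil hz, map_smul] at this
    rw [map_smul]
    exact this
  refine ⟨s, _, ‖s‖ ^ 2, hs, rfl, hpsi, fun hK => ?_, ?_, hσ, hnorm, ?_, ?_⟩
  -- If `K - T` is invertible in `A`, applying its inverse to the vector equation determines `ψ`.
  · have h2 := congrArg (φ.gnsStarAlgHom (resolvent (∑ i, T i) ((1 + ∑ i, r i) / z))) hpsi
    rw [← toL2_eq, ← mul_apply_eq_comp, ← map_mul, resolvent,
      Ring.inverse_mul_cancel _ hK, map_one] at h2
    exact h2.symm
  · rw [inner_smul_right, inner_add_right, hΩs, inner_toL2]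
    simp [h1]
  · rw [hnorm, hform]
  · rw [hnorm, hform]
    congr 4 with i
    rw [hS, l2Norm_resolvent hfam]
    have hz' : ‖z‖ ^ 2 ≠ 0 := by simpa using hz
    have := hx0 i
    have h3 : 1 + x i ≠ 0 := by positivity
    change _ = 1 - ‖z‖ ^ 2 / (‖z‖ ^ 2 * (1 + x i))
    field_simp
    ring

end CStar

/-! ### Operator norm bounds by creation and annihilation operators. -/

section Ring

variable {ι R : Type*} [Fintype ι] [Ring R]

/-- Let `1 - Eᵢ` be compressed to zero by `sᵢ`, for orthogonal idempotents `Eᵢ`. Then alternating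
words in the `sᵢ` are products of creation operators `sᵢ (1 - Eᵢ)`, at most one diagonal operator
`Eᵢ sᵢ Eᵢ`, and annihilation operators `(1 - Eᵢ) sᵢ Eᵢ`, in this order. -/
theorem altSumFrom_succ_succ_eq {E s : ι → R} (hE : ∀ i, E i * E i = E i)
    (hEE : ∀ i j, i ≠ j → E i * E j = 0) (hs : ∀ i, (1 - E i) * s i * (1 - E i) = 0) (n : ℕ)
    (i : ι) :
    altSumFrom s (n + 2) i = s i * (1 - E i) * altSum s (n + 1)
      - s i * (1 - E i) * ((1 - E i) * s i * E i) * (∑ j, (1 - E j) * s j * E j) ^ n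
      + s i * E i * (∑ j, (1 - E j) * s j * E j) ^ (n + 1) := by
  classical
  set a : R := ∑ j, (1 - E j) * s j * E j with ha
  have hE' : ∀ i, (1 - E i) * E i = 0 := fun i => by rw [sub_mul, hE, one_mul, sub_self]
  have hE'' : ∀ i, E i * (1 - E i) = 0 := fun i => by rw [mul_sub, hE, mul_one, sub_self]
  have hidem : ∀ i, (1 - E i) * (1 - E i) = 1 - E i := fun i => by
    rw [mul_sub, hE', mul_one, sub_zero]
  have step : ∀ n, (∀ i, (1 - E i) * altSumFrom s (n + 1) i = (1 - E i) * s i * E i * a ^ n) →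
      ∀ i, altSumFrom s (n + 2) i = s i * (1 - E i) * altSum s (n + 1)
        - s i * (1 - E i) * ((1 - E i) * s i * E i) * a ^ n + s i * E i * a ^ (n + 1) := by
    intro n h1 i
    have h2 : E i * (altSum s (n + 1) - altSumFrom s (n + 1) i) = E i * a ^ (n + 1) := by
      -- For `j ≠ i`, `E i * E j = 0` lets `1 - E j` be inserted after `E i`, and the induction
      -- hypothesis applies; for `j = i` both sides vanish. The sum over `j` produces one more
      -- factor `a`.
      have h3 : ∀ j, E i * altSumFrom s (n + 1) j - (if j = i then E i * altSumFrom s (n + 1) i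
          else 0) = E i * ((1 - E j) * s j * E j * a ^ n) := fun j => by
        split_ifs with hj
        · subst hj
          simp only [← mul_assoc, hE'', zero_mul, sub_self]
        · rw [sub_zero, ← h1, ← mul_assoc, mul_sub, hEE i j (Ne.symm hj), mul_one, sub_zero]
      have h4 := Finset.sum_congr (rfl : Finset.univ = Finset.univ) fun j _ => h3 j
      rw [Finset.sum_sub_distrib, Finset.sum_ite_eq', if_pos (Finset.mem_univ i),
        ← Finset.mul_sum, ← Finset.mul_sum, ← altSum_succ, ← Finset.sum_mul, ← ha,
        ← pow_succ'] at h4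
      rw [mul_sub, h4]
    have h4 : s i * (altSum s (n + 1) - altSumFrom s (n + 1) i) =
        s i * (1 - E i) * altSum s (n + 1) - s i * ((1 - E i) * altSumFrom s (n + 1) i) +
        s i * (E i * (altSum s (n + 1) - altSumFrom s (n + 1) i)) := by noncomm_ring
    have h5 : (1 - E i) * ((1 - E i) * s i * E i) = (1 - E i) * s i * E i := by
      simp only [← mul_assoc, hidem]
    rw [altSumFrom_succ, h4, h2, h1, mul_assoc (s i) (1 - E i) ((1 - E i) * s i * E i), h5]
    simp only [mul_assoc]
  refine step n ?_ i
  clear i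
  induction n with
  | zero =>
    intro i
    have := hs i
    rw [mul_sub, mul_one, sub_eq_zero] at this
    simpa [altSumFrom_succ] using this
  | succ n ih =>
    intro i
    rw [step n ih]
    -- After multiplication by `1 - E i` the terms that start with a creation vanish, and only
    -- annihilations remain.
    have h6 : (1 - E i) * (s i * (1 - E i)) = 0 := by rw [← mul_assoc, hs]
    simp only [mul_add, mul_sub (1 - E i) (_ * _), ← mul_assoc (1 - E i), mul_assoc (s i * _)]
    simp only [mul_assoc (1 - E i), h6]
    simp only [← mul_assoc, zero_mul, sub_zero, zero_add]

end Ring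

section Recursion

variable {R : Type*} [NormedRing R]

/-- Solutions of `w (n + 1) = c w n + g n` are absolutely summable if the powers of `c` and `g`
are. -/
theorem summable_norm_of_recursion {c : R} {w g : ℕ → R} (hw : ∀ n, w (n + 1) = c * w n + g n)
    (hw0 : w 0 = 1) (hc : Summable fun n => ‖c ^ n‖) (hg : Summable fun n => ‖g n‖) :
    Summable fun n => ‖w n‖ := by
  -- Variation of constants: the solution is a power of `c` plus a Cauchy product of two absolutely
  -- summable sequences.
  have h : ∀ n, w (n + 1) = c ^ (n + 1) +
      ∑ kl ∈ Finset.HasAntidiagonal.antidiagonal n, c ^ kl.1 * g kl.2 := by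
    intro n
    induction n with
    | zero => simp [hw, hw0]
    | succ n ih =>
      rw [hw, ih, Finset.Nat.sum_antidiagonal_succ, mul_add, ← pow_succ', Finset.mul_sum]
      simp only [pow_succ' c, mul_assoc, pow_zero, one_mul]
      abel
  rw [← summable_nat_add_iff 1]
  simp only [h]
  exact Summable.of_nonneg_of_le (fun _ => norm_nonneg _) (fun n => norm_add_le _ _)
    (((summable_nat_add_iff 1).2 hc).add
      (summable_norm_sum_mul_antidiagonal_of_summable_norm hc hg))

end Recursion

section Hilbert

variable {ι H : Type*} [NormedAddCommGroup H] [InnerProductSpace ℂ H]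

theorem norm_sq_sum_of_orthogonal (F : Finset ι) {v : ι → H}
    (hv : ∀ i j, i ≠ j → inner ℂ (v i) (v j) = 0) : ‖∑ i ∈ F, v i‖ ^ 2 = ∑ i ∈ F, ‖v i‖ ^ 2 := by
  classical
  have h : inner ℂ (∑ i ∈ F, v i) (∑ i ∈ F, v i) = ∑ i ∈ F, inner ℂ (v i) (v i) := by
    rw [sum_inner]
    refine Finset.sum_congr rfl fun i hi => ?_
    rw [inner_sum, Finset.sum_eq_single i (fun j _ hj => hv i j hj.symm) (fun h => absurd hi h)]
  simp only [inner_self_eq_norm_sq_to_K] at h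
  exact Complex.ofReal_injective (by simpa using h)

variable [Fintype ι]

/-- Creation operators with orthogonal ranges: the powers of their sum are bounded by the sums over
alternating words. -/
theorem norm_sum_pow_sq_le {c : ι → H →L[ℂ] H} {x : ι → ℝ} (hx : ∀ i, 0 ≤ x i)
    (hcc : ∀ i, c i * c i = 0) (horth : ∀ i j, i ≠ j → ∀ ξ η, inner ℂ (c i ξ) (c j η) = 0)
    (hnorm : ∀ i ξ, ‖c i ξ‖ ^ 2 ≤ x i * ‖ξ‖ ^ 2) (n : ℕ) :
    ‖(∑ i, c i) ^ n‖ ^ 2 ≤ altSum x n := by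
  classical
  -- Since `c i * c i = 0`, the next factor uses some `j ≠ i`; Pythagoras over `j` reproduces the
  -- recursion of `altSumFrom`.
  have h1 : ∀ n ξ i, ‖c i (((∑ i, c i) ^ n) ξ)‖ ^ 2 ≤ altSumFrom x (n + 1) i * ‖ξ‖ ^ 2 := by
    intro n ξ
    induction n with
    | zero => intro i; simpa [altSumFrom_succ] using hnorm i ξ
    | succ n ih =>
      intro i
      have h2 : c i (((∑ i, c i) ^ (n + 1)) ξ) =
          c i (∑ j ∈ Finset.univ.erase i, c j (((∑ i, c i) ^ n) ξ)) := by
        rw [pow_succ' (∑ i, c i), mul_apply_eq_comp, _root_.sum_apply,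
          ← Finset.add_sum_erase _ (fun j => c j _) (Finset.mem_univ i), map_add,
            ← mul_apply_eq_comp, hcc]
        simp
      rw [h2, altSumFrom_succ]
      refine (hnorm i _).trans ?_
      rw [norm_sq_sum_of_orthogonal _ fun i j hij => horth i j hij _ _, mul_assoc]
      refine mul_le_mul_of_nonneg_left ?_ (hx i)
      rw [altSum_succ, ← Finset.add_sum_erase _ (altSumFrom x (n + 1)) (Finset.mem_univ i),
        add_sub_cancel_left,
        Finset.sum_mul]
      exact Finset.sum_le_sum fun j _ => ih j
  have h0 := altSum_nonneg hx n
  have h3 : ∀ ξ, ‖((∑ i, c i) ^ n) ξ‖ ≤ √(altSum x n) * ‖ξ‖ := fun ξ => by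
    rw [← sq_le_sq₀ (norm_nonneg _) (by positivity), mul_pow, Real.sq_sqrt h0]
    cases n with
    | zero => simp
    | succ n =>
      rw [pow_succ' (∑ i, c i), mul_apply_eq_comp, _root_.sum_apply,
        norm_sq_sum_of_orthogonal _ fun i j hij => horth i j hij _ _, altSum_succ, Finset.sum_mul]
      exact Finset.sum_le_sum fun i _ => h1 n ξ i
  have h4 := ContinuousLinearMap.opNorm_le_bound _ (Real.sqrt_nonneg _) h3
  calc ‖(∑ i, c i) ^ n‖ ^ 2 ≤ √(altSum x n) ^ 2 := by gcongr
    _ = altSum x n := Real.sq_sqrt h0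

/-- The available bounds are on squares. The inequality `y ≤ t⁻ⁿ + tⁿ y²` passes to first powers at
the cost of a geometric weight, hence the need for `t > 1`. -/
theorem summable_of_sq_le {y w : ℕ → ℝ} (hy : ∀ n, 0 ≤ y n) {t : ℝ} (ht : 1 < t)
    (hw : Summable fun n => t ^ n * w n) (h : ∀ n, y n ^ 2 ≤ w n) : Summable y := by
  have ht0 : 0 < t := zero_lt_one.trans ht
  have hgeo : Summable fun n : ℕ => t⁻¹ ^ n :=
    summable_geometric_of_lt_one (by positivity) (inv_lt_one_of_one_lt₀ ht)
  refine Summable.of_nonneg_of_le hy (fun n => ?_) (hgeo.add hw)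
  have h1 : t⁻¹ ^ n * t ^ n = 1 := by rw [← mul_pow, inv_mul_cancel₀ ht0.ne', one_pow]
  have h2 : 0 < t ^ n := by positivity
  have h3 : 0 < t⁻¹ ^ n := by positivity
  have h4 := mul_le_mul_of_nonneg_left (h n) h2.le
  have h5 : y n ≤ t⁻¹ ^ n + t ^ n * y n ^ 2 := by
    nlinarith [mul_nonneg h2.le (sq_nonneg (y n - t⁻¹ ^ n)), hy n]
  linarith

variable [CompleteSpace H]

/-- The sums over alternating words of operators that act like centred elements on a free product
space are absolutely summable in operator norm if they are summable at the level of the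
creation operators. -/
theorem summable_norm_altSumFrom {E s : ι → H →L[ℂ] H} {x : ι → ℝ} (hx : ∀ i, 0 ≤ x i)
    (hsum : ∑ i, x i / (1 + x i) < 1)
    (hsa : ∀ i, star (E i) = E i) (hE : ∀ i, E i * E i = E i)
    (hEE : ∀ i j, i ≠ j → E i * E j = 0)
    (hs : ∀ i, (1 - E i) * s i * (1 - E i) = 0)
    (hnorm : ∀ i ξ, ‖(s i * (1 - E i)) ξ‖ ^ 2 ≤ x i * ‖ξ‖ ^ 2)
    (hnorm' : ∀ i ξ, ‖(star (s i) * (1 - E i)) ξ‖ ^ 2 ≤ x i * ‖ξ‖ ^ 2) :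
    (Summable fun n => ‖altSum s n‖) ∧ ∀ i, Summable fun n => ‖altSumFrom s n i‖ := by
  obtain ⟨t, ht, htx⟩ := exists_summable_pow_mul_altSum hx hsum
  -- Used for `s` and for `star s`: the creation operators of the latter are the adjoints of the
  -- annihilation operators of the former.
  have hpow : ∀ {r : ι → H →L[ℂ] H}, (∀ i, (1 - E i) * r i * (1 - E i) = 0) →
      (∀ i ξ, ‖(r i * (1 - E i)) ξ‖ ^ 2 ≤ x i * ‖ξ‖ ^ 2) →
      Summable fun n => ‖(∑ i, r i * (1 - E i)) ^ n‖ := fun {r} hr hrn => by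
    have hr' : ∀ i, r i * (1 - E i) = E i * (r i * (1 - E i)) := fun i => by
      have := hr i
      rw [sub_mul, sub_mul, one_mul, sub_eq_zero, mul_assoc] at this
      exact this
    refine summable_of_sq_le (fun n => norm_nonneg _) ht htx
      (norm_sum_pow_sq_le hx (fun i => ?_) (fun i j hij ξ η => ?_) hrn)
    · rw [hr' i]
      have : (1 - E i) * E i = 0 := by rw [sub_mul, hE, one_mul, sub_self]
      rw [mul_assoc, mul_assoc (r i), ← mul_assoc _ (E i), this]
      simp
    · rw [hr' i, hr' j, mul_apply_eq_comp, ← ContinuousLinearMap.adjoint_inner_right,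
        ← ContinuousLinearMap.star_eq_adjoint, hsa, ← mul_apply_eq_comp, ← mul_assoc,
        hEE i j hij]
      simp
  have hc := hpow hs hnorm
  have ha : Summable fun n => ‖(∑ i, (1 - E i) * s i * E i) ^ n‖ := by
    have hstar : ∀ i, (1 - E i) * star (s i) * (1 - E i) = 0 := fun i => by
      have := congrArg star (hs i)
      simpa [hsa, mul_assoc] using this
    have h1 := hpow hstar hnorm'
    refine h1.congr fun n => ?_
    have h2 : ∀ i, star (s i) * (1 - E i) = star ((1 - E i) * s i * E i) := fun i => by
      rw [star_mul, star_mul, star_sub, star_one, hsa, ← mul_assoc]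
      have := hstar i
      rw [sub_mul, sub_mul, one_mul, sub_eq_zero] at this
      exact this
    simp only [h2]
    rw [← star_sum, ← star_pow, norm_star]
  set a := ∑ i, (1 - E i) * s i * E i with ha'
  have hmul : ∀ b : H →L[ℂ] H, ∀ k, Summable fun n => ‖b * a ^ (n + k)‖ := fun b k =>
    Summable.of_nonneg_of_le (fun _ => norm_nonneg _) (fun _ => norm_mul_le _ _)
      (((summable_nat_add_iff k).2 ha).mul_left _)
  have hF := altSumFrom_succ_succ_eq hE hEE hs
  set g : ι → ℕ → H →L[ℂ] H := fun i n => s i * E i * a ^ (n + 1) -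
    s i * (1 - E i) * ((1 - E i) * s i * E i) * a ^ n with hg'
  have hg : ∀ i, Summable fun n => ‖g i n‖ := fun i =>
    Summable.of_nonneg_of_le (fun _ => norm_nonneg _) (fun _ => norm_sub_le _ _)
      ((hmul _ 1).add (hmul _ 0))
  have hF' : ∀ n i, altSumFrom s (n + 2) i = s i * (1 - E i) * altSum s (n + 1) + g i n :=
    fun n i => by rw [hF, ← ha']; simp only [g]; abel
  have hW : Summable fun n => ‖altSum s n‖ := by
    -- `altSum s (n + 1)` is the total creation operator times `altSum s n` plus an inhomogeneity.
    -- At `n = 0` the latter is `∑ s i * E i`, because `altSum s 1 = ∑ s i`.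
    refine summable_norm_of_recursion (c := ∑ i, s i * (1 - E i))
      (g := fun n => Nat.casesOn n (∑ i, s i * E i) fun n => ∑ i, g i n) (fun n => ?_)
      (altSum_zero s) hc ?_
    · cases n with
      | zero =>
        simp only [altSum_succ, altSumFrom_succ, altSum_zero, altSumFrom_zero, sub_zero, mul_one,
          mul_sub, Finset.sum_sub_distrib]
        exact (sub_add_cancel _ _).symm
      | succ n =>
        rw [altSum_succ, Finset.sum_congr rfl fun i _ => hF' n i, Finset.sum_add_distrib,
          Finset.sum_mul]
    · rw [← summable_nat_add_iff 1]
      exact Summable.of_nonneg_of_le (fun _ => norm_nonneg _) (fun n => norm_sum_le _ _)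
        (summable_sum fun i _ => hg i)
  refine ⟨hW, fun i => ?_⟩
  rw [← summable_nat_add_iff 2]
  simp only [hF']
  refine Summable.of_nonneg_of_le (fun _ => norm_nonneg _)
    (fun n => (norm_add_le _ _).trans (add_le_add_left (norm_mul_le _ _) _)) ?_
  exact (((summable_nat_add_iff 1).2 hW).mul_left _).add (hg i)

end Hilbert

/-! ### Realisation on `L²(φ)`: projections onto words with a given first index. -/

section Span

variable {ι A : Type*} [Ring A] [Algebra ℂ A]

/-- The span of the products of centred words whose first index satisfies `P`. -/
def wordSpan (φ : A →ₗ[ℂ] ℂ) (B : ι → Subalgebra ℂ A) (P : Option ι → Prop) : Submodule ℂ A :=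
  Submodule.span ℂ {a | ∃ l, IsCenteredWord φ B l ∧ P (headIndex l) ∧ (l.map Prod.snd).prod = a}

variable {φ : A →ₗ[ℂ] ℂ} {B : ι → Subalgebra ℂ A}

/-- If the word begins with `i`, `b` is first merged with that letter. The new letter is then split
into a centred part and a scalar. -/
theorem wordSpan_mul_mem (h1 : φ 1 = 1) {i : ι} {b : A} (hb : b ∈ B i) {a : A}
    (ha : a ∈ wordSpan φ B fun _ => True) : b * a ∈ wordSpan φ B fun _ => True := by
  have key : ∀ e ∈ B i, ∀ l, IsCenteredWord φ B l → headIndex l ≠ some i →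
      e * (l.map Prod.snd).prod ∈ wordSpan φ B fun _ => True := by
    intro e he l hl hli
    have h2 : e * (l.map Prod.snd).prod = (((i, e - φ e • (1 : A)) :: l).map Prod.snd).prod +
        φ e • (l.map Prod.snd).prod := by
      simp [sub_mul]
    rw [h2]
    refine add_mem (Submodule.subset_span ⟨_, isCenteredWord_cons.2
      ⟨⟨(B i).sub_mem he ((B i).smul_mem (B i).one_mem _), by simp [h1]⟩, hli, hl⟩, trivial, rfl⟩)
      (Submodule.smul_mem _ _ (Submodule.subset_span ⟨l, hl, trivial, rfl⟩))
  induction ha using Submodule.span_induction with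
  | zero => simp
  | add x y _ _ hx hy => rw [mul_add]; exact add_mem hx hy
  | smul c x _ hx => rw [mul_smul_comm]; exact Submodule.smul_mem _ _ hx
  | mem x hx =>
    obtain ⟨l, hl, -, rfl⟩ := hx
    by_cases hli : headIndex l = some i
    · rcases l with _ | ⟨⟨j, e⟩, l⟩
      · simp at hli
      · simp at hli
        subst hli
        rw [isCenteredWord_cons] at hl
        rw [List.map_cons, List.prod_cons, ← mul_assoc]
        exact key _ ((B j).mul_mem hb hl.1.1) l hl.2.2 hl.2.1
    · exact key b hb l hl hli

theorem adjoin_le_wordSpan (h1 : φ 1 = 1) {a : A}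
    (ha : a ∈ Algebra.adjoin ℂ (⋃ i, (B i : Set A))) : a ∈ wordSpan φ B fun _ => True := by
  suffices h : ∀ x ∈ wordSpan φ B fun _ => True, a * x ∈ wordSpan φ B fun _ => True by
    simpa using h 1 (Submodule.subset_span ⟨[], isCenteredWord_nil, trivial, by simp⟩)
  induction ha using Algebra.adjoin_induction with
  | mem b hb =>
    obtain ⟨i, hi⟩ := Set.mem_iUnion.1 hb
    exact fun x hx => wordSpan_mul_mem h1 hi hx
  | algebraMap r =>
    intro x hx
    rw [← Algebra.smul_def]
    exact Submodule.smul_mem _ _ hx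
  | add a b _ _ ha hb => intro x hx; rw [add_mul]; exact add_mem (ha x hx) (hb x hx)
  | mul a b _ _ ha hb => intro x hx; rw [mul_assoc]; exact ha _ (hb x hx)

theorem wordSpan_sup (i : ι) : wordSpan φ B (fun _ => True) ≤
    wordSpan φ B (fun j => j = some i) ⊔ wordSpan φ B (fun j => j ≠ some i) := by
  refine Submodule.span_le.2 ?_
  rintro _ ⟨l, hl, -, rfl⟩
  by_cases h : headIndex l = some i
  · exact Submodule.mem_sup_left (Submodule.subset_span ⟨l, hl, h, rfl⟩)
  · exact Submodule.mem_sup_right (Submodule.subset_span ⟨l, hl, h, rfl⟩)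

theorem mul_mem_wordSpan {i : ι} {b : A} (hb : b ∈ B i) (hφ : φ b = 0) {a : A}
    (ha : a ∈ wordSpan φ B fun j => j ≠ some i) : b * a ∈ wordSpan φ B fun j => j = some i := by
  induction ha using Submodule.span_induction with
  | zero => simp
  | add x y _ _ hx hy => rw [mul_add]; exact add_mem hx hy
  | smul c x _ hx => rw [mul_smul_comm]; exact Submodule.smul_mem _ _ hx
  | mem x hx =>
    obtain ⟨l, hl, hli, rfl⟩ := hx
    exact Submodule.subset_span ⟨(i, b) :: l, isCenteredWord_cons.2 ⟨⟨hb, hφ⟩, hli, hl⟩, rfl, by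
      simp⟩

variable [StarRing A] [StarModule ℂ A] {S : ι → A}

theorem IsCenteredFreeFamily.star_mul_eq_zero (h : IsCenteredFreeFamily φ B S)
    {P Q : Option ι → Prop} (hPQ : ∀ j, P j → ¬ Q j) {a b : A} (ha : a ∈ wordSpan φ B P)
    (hb : b ∈ wordSpan φ B Q) : φ (Star.star a * b) = 0 := by
  induction ha using Submodule.span_induction with
  | zero => simp
  | add x y _ _ hx hy => rw [star_add, add_mul, map_add, hx, hy, add_zero]
  | smul c x _ hx => rw [star_smul, smul_mul_assoc, map_smul, hx, smul_zero]
  | mem x hx =>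
    obtain ⟨l, hl, hli, rfl⟩ := hx
    induction hb using Submodule.span_induction with
    | zero => simp
    | add x y _ _ hx hy => rw [mul_add, map_add, hx, hy, add_zero]
    | smul c x _ hx => rw [mul_smul_comm, map_smul, hx, smul_zero]
    | mem y hy =>
      obtain ⟨m, hm, hmi, rfl⟩ := hy
      exact h.free.star_mul_eq_zero h.star_mem h.map_star hl hm fun e => hPQ _ hli (e ▸ hmi)

theorem IsCenteredFreeFamily.star_mul_mul (h : IsCenteredFreeFamily φ B S) {i : ι} {e : A}
    (he : e ∈ B i) {a b : A} (ha : a ∈ wordSpan φ B fun j => j ≠ some i)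
    (hb : b ∈ wordSpan φ B fun j => j ≠ some i) :
    φ (Star.star a * e * b) = φ e * φ (Star.star a * b) := by
  induction ha using Submodule.span_induction with
  | zero => simp
  | add x y _ _ hx hy => simp only [star_add, add_mul, map_add, hx, hy, mul_add]
  | smul c x _ hx =>
    simp only [star_smul, smul_mul_assoc, map_smul, hx, smul_eq_mul]
    ring
  | mem x hx =>
    obtain ⟨l, hl, hli, rfl⟩ := hx
    induction hb using Submodule.span_induction with
    | zero => simp
    | add x y _ _ hx hy => simp only [mul_add, map_add, hx, hy]
    | smul c x _ hx =>
      simp only [mul_smul_comm, map_smul, hx, smul_eq_mul]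
      ring
    | mem y hy =>
      obtain ⟨m, hm, hmi, rfl⟩ := hy
      exact h.free.star_mul_mul h.map_one h.star_mem h.map_star hl hm he hli hmi

end Span

section Projection

variable {ι D : Type*} [CStarAlgebra D] [PartialOrder D] [StarOrderedRing D]
  {φ : D →ₚ[ℂ] ℂ} {B : ι → Subalgebra ℂ D} {S : ι → D}

/-- The closed subspace of `L²(φ)` spanned by the centred words beginning with `i`. -/
noncomputable def wordSpace (φ : D →ₚ[ℂ] ℂ) (B : ι → Subalgebra ℂ D) (i : ι) :
    Submodule ℂ φ.GNS :=
  ((wordSpan φ.toLinearMap B fun j => j = some i).map (toL2Linear φ)).topologicalClosure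

instance (i : ι) : CompleteSpace (wordSpace φ B i) :=
  (Submodule.isClosed_topologicalClosure _).completeSpace_coe

/-- The projection onto the span of the centred words beginning with `i`. -/
noncomputable def wordProj (φ : D →ₚ[ℂ] ℂ) (B : ι → Subalgebra ℂ D) (i : ι) :
    φ.GNS →L[ℂ] φ.GNS :=
  (wordSpace φ B i).starProjection

theorem toL2_mem_wordSpace {i : ι} {a : D}
    (ha : a ∈ wordSpan φ.toLinearMap B fun j => j = some i) : toL2 φ a ∈ wordSpace φ B i :=
  subset_closure ⟨a, ha, rfl⟩

theorem wordProj_of_mem {i : ι} {a : D}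
    (ha : a ∈ wordSpan φ.toLinearMap B fun j => j = some i) :
    wordProj φ B i (toL2 φ a) = toL2 φ a :=
  Submodule.starProjection_eq_self_iff.2 (toL2_mem_wordSpace ha)

theorem mem_orthogonal_wordSpace {i : ι} {ξ : φ.GNS}
    (h : ∀ a ∈ wordSpan φ.toLinearMap B (fun j => j = some i), inner ℂ (toL2 φ a) ξ = 0) :
    ξ ∈ (wordSpace φ B i)ᗮ := by
  rw [wordSpace, Submodule.orthogonal_closure, Submodule.mem_orthogonal]
  rintro _ ⟨a, ha, rfl⟩
  exact h a ha

theorem IsCenteredFreeFamily.wordProj_eq_zero (h : IsCenteredFreeFamily φ.toLinearMap B S) {i : ι}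
    {a : D} (ha : a ∈ wordSpan φ.toLinearMap B fun j => j ≠ some i) :
    wordProj φ B i (toL2 φ a) = 0 := by
  refine (Submodule.starProjection_apply_eq_zero_iff _).2 (mem_orthogonal_wordSpace fun b hb => ?_)
  rw [inner_toL2]
  exact h.star_mul_eq_zero (fun j h1 h2 => h2 h1) hb ha

theorem IsCenteredFreeFamily.wordProj_mul (h : IsCenteredFreeFamily φ.toLinearMap B S) {i j : ι}
    (hij : i ≠ j) : wordProj φ B i * wordProj φ B j = 0 := by
  refine Submodule.IsOrtho.starProjection_comp_starProjection ?_
  rw [Submodule.isOrtho_iff_le]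
  refine Submodule.topologicalClosure_minimal _ ?_ (Submodule.isClosed_orthogonal _)
  rintro _ ⟨a, ha, rfl⟩
  refine mem_orthogonal_wordSpace fun b hb => ?_
  rw [toL2Linear_apply, inner_toL2]
  exact h.star_mul_eq_zero (fun k h1 h2 => hij (by simpa using h2.symm.trans h1)) hb ha

theorem denseRange_wordSpan (h1 : φ 1 = 1)
    (hd : Dense (Algebra.adjoin ℂ (⋃ i, (B i : Set D)) : Set D)) :
    Dense (toL2 φ '' (wordSpan φ.toLinearMap B fun _ => True)) :=
  ((denseRange_toL2 φ).dense_image (continuous_toL2 φ) hd).mono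
    (Set.image_mono fun _ ha => adjoin_le_wordSpan h1 ha)

/-- A property of the vectors orthogonal to the words beginning with `i` can be checked on the words
that do not begin with `i`. -/
theorem IsCenteredFreeFamily.one_sub_wordProj_induction
    (h : IsCenteredFreeFamily φ.toLinearMap B S)
    (hd : Dense (Algebra.adjoin ℂ (⋃ i, (B i : Set D)) : Set D)) (i : ι) {P : φ.GNS → Prop}
    (hP : IsClosed {ξ | P ((1 - wordProj φ B i) ξ)})
    (hw : ∀ a ∈ wordSpan φ.toLinearMap B (fun j => j ≠ some i), P (toL2 φ a)) (ξ : φ.GNS) :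
    P ((1 - wordProj φ B i) ξ) := by
  refine (denseRange_wordSpan h.map_one hd).induction ?_ hP ξ
  rintro _ ⟨a, ha, rfl⟩
  obtain ⟨b, hb, c, hc, rfl⟩ := Submodule.mem_sup.1 (wordSpan_sup i ha)
  have : (1 - wordProj φ B i) (toL2 φ (b + c)) = toL2 φ c := by
    rw [← toL2Linear_apply, map_add, map_add]
    simp only [toL2Linear_apply]
    change toL2 φ b - wordProj φ B i (toL2 φ b) + (toL2 φ c - wordProj φ B i (toL2 φ c)) = _
    rw [wordProj_of_mem hb, h.wordProj_eq_zero hc]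
    simp
  rw [this]
  exact hw c hc

/-- Being centred, `S i` maps words not beginning with `i` to words that begin with `i`. -/
theorem IsCenteredFreeFamily.compress_eq_zero (h : IsCenteredFreeFamily φ.toLinearMap B S)
    (hd : Dense (Algebra.adjoin ℂ (⋃ i, (B i : Set D)) : Set D)) (i : ι) :
    (1 - wordProj φ B i) * φ.gnsStarAlgHom (S i) * (1 - wordProj φ B i) = 0 := by
  ext ξ
  have := h.one_sub_wordProj_induction hd i
    (P := fun η => ((1 - wordProj φ B i) * φ.gnsStarAlgHom (S i)) η = 0)
    (isClosed_eq (by fun_prop) (by fun_prop)) (fun a ha => ?_) ξ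
  · exact this
  · rw [mul_apply_eq_comp, gns_toL2]
    have h2 := wordProj_of_mem (mul_mem_wordSpan (h.mem i) (h.centered i) ha)
    change _ - wordProj φ B i _ = 0
    rw [h2]
    simp

/-- On words `a` not beginning with `i`, freeness splits `φ (a* S_i* S_i a)` as `φ (S_i* S_i) φ (a*
a)`: creation is a multiple of an isometry there. -/
theorem IsCenteredFreeFamily.norm_creation_sq (h : IsCenteredFreeFamily φ.toLinearMap B S)
    (hd : Dense (Algebra.adjoin ℂ (⋃ i, (B i : Set D)) : Set D)) (i : ι) (ξ : φ.GNS) :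
    ‖(φ.gnsStarAlgHom (S i) * (1 - wordProj φ B i)) ξ‖ ^ 2 ≤ l2Norm φ (S i) ^ 2 * ‖ξ‖ ^ 2 := by
  have h1 := h.one_sub_wordProj_induction hd i
    (P := fun η => ‖φ.gnsStarAlgHom (S i) η‖ ^ 2 = l2Norm φ (S i) ^ 2 * ‖η‖ ^ 2)
    (isClosed_eq (by fun_prop) (by fun_prop)) (fun a ha => ?_) ξ
  · rw [mul_apply_eq_comp, h1]
    gcongr
    have h2 : (1 - wordProj φ B i) ξ = (wordSpace φ B i)ᗮ.starProjection ξ :=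
      (Submodule.starProjection_orthogonal_val ξ).symm
    rw [h2]
    exact Submodule.norm_starProjection_apply_le _ ξ
  · rw [gns_toL2, norm_toL2, norm_toL2, ← Complex.ofReal_inj, Complex.ofReal_mul,
      ← apply_star_mul_self, ← apply_star_mul_self, ← apply_star_mul_self]
    have := h.star_mul_mul ((B i).mul_mem (h.star_mem i _ (h.mem i)) (h.mem i)) ha ha
    rw [star_mul, mul_assoc, ← mul_assoc (Star.star (S i)), ← mul_assoc]
    exact this

/-- In a `C*`-algebra with faithful tracial state, generated by free `*`-subalgebras, the sums over
alternating words are absolutely summable if the sums of their `L²`-norms are. -/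
theorem IsCenteredFreeFamily.summable_norm_altSum [Fintype ι]
    (h : IsCenteredFreeFamily φ.toLinearMap B S)
    (hd : Dense (Algebra.adjoin ℂ (⋃ i, (B i : Set D)) : Set D))
    (hfaith : ∀ a, φ (Star.star a * a) = 0 → a = 0) (htr : ∀ a b, φ (a * b) = φ (b * a))
    (hlt : ∑ i, l2Norm φ (S i) ^ 2 / (1 + l2Norm φ (S i) ^ 2) < 1) :
    (Summable fun n => ‖altSum S n‖) ∧ ∀ i, Summable fun n => ‖altSumFrom S n i‖ := by
  -- Faithfulness makes the GNS representation injective, hence isometric, so operator bounds are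
  -- bounds in `D`.
  have hinj : Function.Injective φ.gnsStarAlgHom := by
    refine (injective_iff_map_eq_zero _).2 fun a ha => hfaith a ?_
    rw [apply_star_mul_self, ← norm_toL2, toL2_eq, ha]
    simp
  have hmap : ∀ n i, φ.gnsStarAlgHom (altSumFrom S n i) =
      altSumFrom (fun i => φ.gnsStarAlgHom (S i)) n i := fun n i => by
    simp [altSumFrom, map_list_prod, Function.comp_def]
  have hmap' : ∀ n, φ.gnsStarAlgHom (altSum S n) = altSum (fun i => φ.gnsStarAlgHom (S i)) n :=
    fun n => map_altSum (φ.gnsStarAlgHom : D →+* (φ.GNS →L[ℂ] φ.GNS)) S n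
  have key := summable_norm_altSumFrom (s := fun i => φ.gnsStarAlgHom (S i))
    (E := wordProj φ B) (fun i => sq_nonneg (l2Norm φ (S i))) hlt
    (fun i => (isSelfAdjoint_starProjection _).star_eq)
    (fun i => (wordSpace φ B i).isIdempotentElem_starProjection)
    (fun i j hij => h.wordProj_mul hij) (h.compress_eq_zero hd) (h.norm_creation_sq hd)
    (fun i ξ => by
      have h1 := h.star.norm_creation_sq hd i ξ
      -- Traciality is used here: the annihilation operators obey the same bound as the creation
      -- operators.
      have h2 : l2Norm φ (Star.star (S i)) = l2Norm φ (S i) := by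
        rw [l2Norm, l2Norm, star_star, htr]
      rw [h2, StarHomClass.map_star] at h1
      exact h1)
  simp only [← hmap, ← hmap', NonUnitalStarAlgHom.norm_map _ hinj] at key
  exact key

end Projection

/-! ### Reduction to the generated `C*`-algebra and the bounded resolvent. -/

section Generated

/-- A reversed word in the `S i` is the adjoint of a word in the `star (S i)`, and the adjoint is
isometric. -/
theorem tendsto_altSumFrom_op {ι A : Type*} [Finite ι] [CStarAlgebra A] {S : ι → A}
    (h : ∀ i, Summable fun n => ‖altSumFrom (fun i => star (S i)) n i‖) (i : ι) :
    Tendsto (fun n => altSumFrom (fun i => MulOpposite.op (S i)) (n + 1) i) atTop (𝓝 0) := by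
  have h1 : ∀ n, altSumFrom (fun i => MulOpposite.op (S i)) n i =
      MulOpposite.op (star (altSumFrom (fun i => star (S i)) n i)) := fun n => by
    change _ = (starRingEquiv : A ≃+* Aᵐᵒᵖ) _
    simp [altSumFrom, map_list_prod, Function.comp_def]
  rw [tendsto_zero_iff_norm_tendsto_zero]
  simp only [h1, MulOpposite.norm_op, norm_star]
  exact ((summable_nat_add_iff 1).2 (h i)).tendsto_atTop_zero

variable {ι A : Type*} [Fintype ι] [CStarAlgebra A] [PartialOrder A] [StarOrderedRing A]
  {φ : A →ₚ[ℂ] ℂ}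

/-- The restriction of a positive functional to a closed `*`-subalgebra. -/
noncomputable def restrictPositive (φ : A →ₚ[ℂ] ℂ) (D : StarSubalgebra ℂ A)
    [IsClosed (D : Set A)] :
    letI := CStarAlgebra.spectralOrder D
    D →ₚ[ℂ] ℂ :=
  letI := CStarAlgebra.spectralOrder D
  letI := CStarAlgebra.spectralOrderedRing D
  PositiveLinearMap.mk₀ (φ.toLinearMap ∘ₗ D.toSubalgebra.toSubmodule.subtype) fun x hx => by
    obtain ⟨y, rfl⟩ := CStarAlgebra.nonneg_iff_eq_star_mul_self.1 hx
    exact φ.map_nonneg (star_mul_self_nonneg (y : A))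

/-- The centred words need to be dense in `L²`, so `A` is replaced by the `C*`-algebra `D` generated
by the `T i`; this leaves norms and `φ` unchanged. -/
theorem summable_norm_altSum_of_faithful {T S : ι → A}
    (h : IsCenteredFreeFamily φ.toLinearMap
      (fun i => (StarAlgebra.elemental ℂ (T i)).toSubalgebra) S)
    (hfaith : ∀ a, φ (star a * a) = 0 → a = 0) (htr : ∀ a b, φ (a * b) = φ (b * a))
    (hlt : ∑ i, l2Norm φ (S i) ^ 2 / (1 + l2Norm φ (S i) ^ 2) < 1) :
    (Summable fun n => ‖altSum S n‖) ∧ ∀ i, Summable fun n => ‖altSumFrom S n i‖ := by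
  set D : StarSubalgebra ℂ A := (StarAlgebra.adjoin ℂ (Set.range T)).topologicalClosure with hD
  have : IsClosed (D : Set A) := StarSubalgebra.isClosed_topologicalClosure _
  let _ := CStarAlgebra.spectralOrder D
  have := CStarAlgebra.spectralOrderedRing D
  have hle : ∀ i, StarAlgebra.elemental ℂ (T i) ≤ D := fun i =>
    StarAlgebra.elemental.le_of_mem ‹_› (StarSubalgebra.le_topologicalClosure _
      (StarAlgebra.subset_adjoin ℂ _ ⟨i, rfl⟩))
  let S' : ι → D := fun i => ⟨S i, hle i (h.mem i)⟩
  let B' : ι → Subalgebra ℂ D := fun i =>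
    (StarAlgebra.elemental ℂ (T i)).toSubalgebra.comap D.subtype.toAlgHom
  have hfam : IsCenteredFreeFamily (restrictPositive φ D).toLinearMap B' S' :=
    { map_one := h.map_one
      map_star := fun a => h.map_star a
      star_mem := fun i a ha => h.star_mem i _ ha
      free := fun l h0 hl hc => by
        have := h.free (l.map fun p => (p.1, (p.2 : A))) (by simpa using h0)
          (by
            intro p hp
            obtain ⟨q, hq, rfl⟩ := List.mem_map.1 hp
            exact hl q hq)
          (by rw [List.isChain_map]; exact hc)
        have h2 : ((l.map fun p => (p.1, (p.2 : A))).map Prod.snd).prod =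
            D.subtype (l.map Prod.snd).prod := by
          rw [map_list_prod]; simp [Function.comp_def]
        rw [h2] at this
        exact this
      mem := fun i => h.mem i
      centered := fun i => h.centered i }
  have hnorm : ∀ a : D, l2Norm (restrictPositive φ D) a = l2Norm φ a := fun a => rfl
  have hdense : Dense (Algebra.adjoin ℂ (⋃ i, (B' i : Set D)) : Set D) := by
    have h1 : (StarAlgebra.adjoin ℂ (Set.range T)).toSubalgebra ≤
        (Algebra.adjoin ℂ (⋃ i, (B' i : Set D))).map D.subtype.toAlgHom := by
      rw [StarAlgebra.adjoin_toSubalgebra]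
      refine Algebra.adjoin_le ?_
      have h2 : ∀ i, ∀ a ∈ StarAlgebra.elemental ℂ (T i),
          a ∈ (Algebra.adjoin ℂ (⋃ i, (B' i : Set D))).map D.subtype.toAlgHom := fun i a ha =>
        ⟨⟨a, hle i ha⟩, Algebra.subset_adjoin (Set.mem_iUnion.2 ⟨i, ha⟩), rfl⟩
      rintro a (⟨i, rfl⟩ | ⟨i, hi⟩)
      · exact h2 i _ (StarAlgebra.elemental.self_mem ℂ _)
      · rw [← star_star a, ← hi]
        exact h2 i _ (StarAlgebra.elemental.star_self_mem ℂ _)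
    rw [Subtype.dense_iff]
    exact closure_mono h1
  have key := hfam.summable_norm_altSum hdense
    (fun a ha => Subtype.ext (hfaith a ha)) (fun a b => htr a b) hlt
  have h1 : ∀ n, ((altSum S' n : D) : A) = altSum S n := fun n =>
    map_altSum (D.subtype : D →+* A) S' n
  have h2 : ∀ n i, ((altSumFrom S' n i : D) : A) = altSumFrom S n i := fun n i => by
    change D.subtype _ = _
    simp only [altSumFrom, map_sum, map_list_prod, List.map_map, Function.comp_def]
    rfl
  simp only [← h1, ← h2]
  exact key

/-- For a faithful tracial state, convergence of the resolvent series in `L²(φ)` implies convergence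
in operator norm. -/
theorem bounded_resolvent_formula {T S : ι → A} {z : ℂ} {r : ι → ℂ}
    (hfam : IsCenteredFreeFamily φ.toLinearMap
      (fun i => (StarAlgebra.elemental ℂ (T i)).toSubalgebra) S) (hz : z ≠ 0)
    (hk : ∀ i, (1 + r i) / z ∈ resolventSet ℂ (T i))
    (hS : ∀ i, resolvent (T i) ((1 + r i) / z) = z • (1 + S i))
    (hfaith : ∀ a, φ (star a * a) = 0 → a = 0) (htr : ∀ a b, φ (a * b) = φ (b * a))
    (hsum : Summable fun n : ℕ => toL2 φ (altSum S (n + 1))) :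
    (1 + ∑ i, r i) / z ∈ resolventSet ℂ (∑ i, T i) ∧
      φ (resolvent (∑ i, T i) ((1 + ∑ i, r i) / z)) = z ∧
      ∃ s : A, HasSum (fun n : ℕ => altSum S (n + 1)) s ∧
        resolvent (∑ i, T i) ((1 + ∑ i, r i) / z) = z • (1 + s) := by
  have hlt := lt_one_of_summable_altSum (fun i => sq_nonneg (l2Norm φ (S i)))
    (hfam.summable_toL2_iff.1 hsum)
  have hstar : ∀ i, l2Norm φ (star (S i)) = l2Norm φ (S i) := fun i => by
    rw [l2Norm, l2Norm, star_star, htr]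
  obtain ⟨h1, h2⟩ := summable_norm_altSum_of_faithful hfam hfaith htr hlt
  obtain ⟨-, h3⟩ := summable_norm_altSum_of_faithful hfam.star hfaith htr
    (by simpa only [hstar] using hlt)
  obtain ⟨s, hs⟩ := ((summable_nat_add_iff 1).2 h1).of_norm
  obtain ⟨h4, h5, h6⟩ := resolvent_of_hasSum hfam hz hk hS hs
    (fun i => ((summable_nat_add_iff 1).2 (h2 i)).of_norm.tendsto_atTop_zero)
    (tendsto_altSumFrom_op h3)
  exact ⟨h4, h6, s, hs, h5⟩

end Generated

/-! ### The formal version. -/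

section CompositionalInverse

open PowerSeries

theorem hasSubst_of_constantCoeff {f : ℂ⟦X⟧} (hf : constantCoeff f = 0) : HasSubst f :=
  HasSubst.of_constantCoeff_zero' hf

/-- A right inverse under composition is a left inverse. -/
theorem subst_eq_X_symm {f h : ℂ⟦X⟧} (hf : constantCoeff f = 0) (hf1 : coeff 1 f = 1)
    (hh : constantCoeff h = 0) (hfh : subst h f = (X : ℂ⟦X⟧)) : subst f h = (X : ℂ⟦X⟧) := by
  have hu : IsUnit (coeff 1 f) := by simp [hf1]
  set g := f.substInvOfIsUnit hu with hg
  have hg0 : constantCoeff g = 0 := constantCoeff_substInvOfIsUnit _ _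
  have hl : subst f g = (X : ℂ⟦X⟧) := subst_substInvOfIsUnit_left f hf hu
  have h1 : subst h (subst f g) = subst (subst h f) g :=
    subst_comp_subst_apply (hasSubst_of_constantCoeff hf) (hasSubst_of_constantCoeff hh) g
  rw [hl, hfh, subst_X (hasSubst_of_constantCoeff hh), X_subst] at h1
  rw [h1, hl]

theorem eq_of_subst_eq_X {f h k : ℂ⟦X⟧} (hf : constantCoeff f = 0) (hf1 : coeff 1 f = 1)
    (hh : constantCoeff h = 0) (hk : constantCoeff k = 0) (hfh : subst h f = (X : ℂ⟦X⟧))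
    (hfk : subst k f = (X : ℂ⟦X⟧)) : h = k := by
  have h1 : subst k (subst f h) = subst (subst k f) h :=
    subst_comp_subst_apply (hasSubst_of_constantCoeff hf) (hasSubst_of_constantCoeff hk) h
  rw [subst_eq_X_symm hf hf1 hh hfh, hfk, subst_X (hasSubst_of_constantCoeff hk), X_subst] at h1
  exact h1.symm

end CompositionalInverse

section Divisibility

open PowerSeries

variable {A : Type*} [Ring A]

/-- An approximate right inverse with defect `d` misses the inverse by a multiple of `d`; here `d`
will be divisible by a high power of `X`. -/
theorem inverse_sub_eq {q y d : A} (hq : IsUnit q) (h : q * y = 1 - d) :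
    Ring.inverse q - y = Ring.inverse q * d := by
  have h1 : y = Ring.inverse q * (q * y) := by
    rw [← mul_assoc, Ring.inverse_mul_cancel _ hq, one_mul]
  rw [h1, h, mul_sub, mul_one, sub_sub_cancel]

theorem X_pow_dvd_mul_left {f : A⟦X⟧} {n : ℕ} (hf : X ^ n ∣ f) (g : A⟦X⟧) : X ^ n ∣ g * f := by
  obtain ⟨c, rfl⟩ := hf
  exact ⟨g * c, by rw [← mul_assoc, ← mul_assoc, (commute_X_pow g n).eq]⟩

theorem coeff_eq_of_X_pow_dvd_sub {f g : A⟦X⟧} {n m : ℕ} (h : X ^ n ∣ f - g) (hm : m < n) :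
    coeff m f = coeff m g := by
  rw [← sub_eq_zero, ← map_sub]
  exact X_pow_dvd_iff.1 h m hm

theorem X_pow_dvd_list_prod {ι : Type*} {S : ι → A⟦X⟧} (hS : ∀ i, X ∣ S i) (w : List ι) :
    X ^ w.length ∣ (w.map S).prod := by
  induction w with
  | nil => simp
  | cons i w ih =>
    obtain ⟨f, hf⟩ := hS i
    obtain ⟨g, hg⟩ := ih
    refine ⟨f * g, ?_⟩
    rw [List.map_cons, List.prod_cons, hf, hg, List.length_cons, pow_succ', mul_assoc, mul_assoc,
      ← mul_assoc f, (commute_X_pow f _).eq, mul_assoc]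

end Divisibility

section Formal

open PowerSeries

variable {A : Type*} [Ring A] [Algebra ℂ A] {φ : A →ₗ[ℂ] ℂ}

theorem constantCoeff_formalCauchy (a : A) : constantCoeff (formalCauchy φ a) = 0 := by
  simp [formalCauchy]

theorem coeff_succ_formalCauchy (a : A) (n : ℕ) :
    coeff (n + 1) (formalCauchy φ a) = φ (a ^ n) := by
  rw [formalCauchy, coeff_succ_X_mul, coeff_mk]

theorem constantCoeff_formalInvK (R : ℂ⟦X⟧) : constantCoeff (formalInvK R) = 0 := by
  simp [formalInvK]

theorem one_add_mul_inv {R : ℂ⟦X⟧} (hR : constantCoeff R = 0) : (1 + R) * (1 + R)⁻¹ = 1 :=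
  PowerSeries.mul_inv_cancel _ (by simp [hR])

theorem formalInvK_injOn {R R' : ℂ⟦X⟧} (hR : constantCoeff R = 0) (hR' : constantCoeff R' = 0)
    (h : formalInvK R = formalInvK R') : R = R' := by
  have h1 : (1 + R)⁻¹ = (1 + R')⁻¹ := mul_left_cancel₀ X_ne_zero h
  have h2 : 1 + R = 1 + R' := by
    calc 1 + R = (1 + R) * ((1 + R') * (1 + R')⁻¹) := by rw [one_add_mul_inv hR', mul_one]
      _ = 1 + R' := by rw [← h1, mul_left_comm, one_add_mul_inv hR, mul_one]
  exact add_left_cancel h2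

theorem exists_formalInvK_eq {h : ℂ⟦X⟧} (h0 : constantCoeff h = 0) (h1' : coeff 1 h = 1) :
    ∃ R : ℂ⟦X⟧, constantCoeff R = 0 ∧ formalInvK R = h := by
  obtain ⟨k, rfl⟩ := X_dvd_iff.2 h0
  have hk : constantCoeff k = 1 := by
    rw [← h1', ← coeff_zero_eq_constantCoeff_apply]
    exact (coeff_succ_X_mul 0 k).symm
  refine ⟨k⁻¹ - 1, by simp [hk], ?_⟩
  rw [formalInvK, add_sub_cancel]
  congr 1
  exact (PowerSeries.inv_eq_iff_mul_eq_one (by simp [hk])).2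
    (PowerSeries.mul_inv_cancel _ (by simp [hk]))

theorem isFormalRTransform_iff (h1 : φ 1 = 1) (a : A) (R : ℂ⟦X⟧) :
    IsFormalRTransform φ a R ↔ constantCoeff R = 0 ∧
      subst (formalInvK R) (formalCauchy φ a) = (X : ℂ⟦X⟧) := by
  refine ⟨fun h => ⟨h.1, h.2.1⟩, fun h => ⟨h.1, h.2, subst_eq_X_symm
    (constantCoeff_formalCauchy a) ?_ (constantCoeff_formalInvK R) h.2⟩⟩
  rw [coeff_succ_formalCauchy a 0]; simpa using h1

/-- The Cauchy series is `w + ⋯` because `φ 1 = 1`, so it has a unique compositional inverse, which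
determines `R`. -/
theorem existsUnique_isFormalRTransform (h1 : φ 1 = 1) (a : A) :
    ∃! R : ℂ⟦X⟧, IsFormalRTransform φ a R := by
  have hc := constantCoeff_formalCauchy (φ := φ) a
  have hc1 : coeff 1 (formalCauchy φ a) = 1 := by
    rw [coeff_succ_formalCauchy a 0]; simpa using h1
  have hu : IsUnit (coeff 1 (formalCauchy φ a)) := by simp [hc1]
  have hinv : coeff 1 ((formalCauchy φ a).substInvOfIsUnit hu) = 1 := by
    rw [coeff_one_substInvOfIsUnit, Units.val_eq_one, inv_eq_one]
    exact Units.ext hc1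
  obtain ⟨R, hR, hR'⟩ := exists_formalInvK_eq (constantCoeff_substInvOfIsUnit _ hu)
    hinv
  refine ⟨R, (isFormalRTransform_iff h1 a R).2 ⟨hR, ?_⟩, fun R' h' => ?_⟩
  · rw [hR']; exact subst_substInvOfIsUnit_right _ hc hu
  · refine formalInvK_injOn h'.1 hR (eq_of_subst_eq_X hc hc1 (constantCoeff_formalInvK _)
      (constantCoeff_formalInvK _) h'.2.1 ?_)
    rw [hR']; exact subst_substInvOfIsUnit_right _ hc hu

theorem commute_map_algebraMap (f : ℂ⟦X⟧) (g : A⟦X⟧) :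
    PowerSeries.map (algebraMap ℂ A) f * g = g * PowerSeries.map (algebraMap ℂ A) f := by
  ext n
  rw [coeff_mul, coeff_mul, ← Finset.Nat.sum_antidiagonal_swap]
  refine Finset.sum_congr rfl fun p _ => ?_
  simp [Algebra.commutes]

theorem isUnit_formalPencil (a : A) {R : ℂ⟦X⟧} (hR : constantCoeff R = 0) :
    IsUnit (formalPencil a R) := by
  rw [isUnit_iff_constantCoeff]
  have : constantCoeff (PowerSeries.map (algebraMap ℂ A) R) = 0 := by
    rw [← coeff_zero_eq_constantCoeff_apply, coeff_map]; simp [hR]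
  simp [formalPencil, this]

/-- Truncated Neumann series: the pencil is `(1 + R) (1 - b)` with `b = z (1 + R)⁻¹ a`, and `X ^ (N
+ 1)` divides `b ^ (N + 1)`. -/
theorem coeff_inverse_formalPencil (a : A) {R : ℂ⟦X⟧} (hR : constantCoeff R = 0) {m N : ℕ}
    (hm : m ≤ N) :
    coeff m (Ring.inverse (formalPencil a R)) =
      ∑ n ∈ Finset.range (N + 1), coeff m (formalInvK R ^ n * (1 + R)⁻¹) • a ^ n := by
  set ρ := PowerSeries.map (algebraMap ℂ A) with hρ
  set b : A⟦X⟧ := ρ (formalInvK R) * C a with hb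
  have hX : ρ (1 + R) * ρ (formalInvK R) = X := by
    rw [← map_mul, formalInvK, mul_left_comm, one_add_mul_inv hR]
    simp [hρ]
  have hQ : formalPencil a R = ρ (1 + R) * (1 - b) := by
    rw [mul_sub, hb, ← mul_assoc, hX, map_add, map_one, mul_one, formalPencil]
  have hinv : ρ (1 + R) * ρ (1 + R)⁻¹ = 1 := by rw [← map_mul, one_add_mul_inv hR, map_one]
  have hbn : ∀ n, b ^ n = ρ (formalInvK R ^ n) * C (a ^ n) := fun n => by
    rw [hb, (show Commute _ _ from commute_map_algebraMap _ _).mul_pow, map_pow, map_pow]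
  have hdvd : X ^ (N + 1) ∣ b ^ (N + 1) := by
    rw [hbn, formalInvK, mul_pow, map_mul, mul_assoc, map_pow, hρ, map_X]
    exact Dvd.intro _ rfl
  have key : formalPencil a R * ((∑ n ∈ Finset.range (N + 1), b ^ n) * ρ (1 + R)⁻¹) =
      1 - b ^ (N + 1) := by
    rw [hQ, mul_assoc, ← mul_assoc (1 - b), mul_neg_geom_sum, ← commute_map_algebraMap,
      ← mul_assoc, hinv, one_mul]
  have hu := isUnit_formalPencil a hR
  have h1 : X ^ (N + 1) ∣ Ring.inverse (formalPencil a R) -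
      (∑ n ∈ Finset.range (N + 1), b ^ n) * ρ (1 + R)⁻¹ := by
    rw [inverse_sub_eq hu key]
    exact X_pow_dvd_mul_left hdvd _
  rw [coeff_eq_of_X_pow_dvd_sub h1 (Nat.lt_succ_of_le hm), Finset.sum_mul, map_sum]
  refine Finset.sum_congr rfl fun n _ => ?_
  rw [hbn, mul_assoc, ← commute_map_algebraMap, ← mul_assoc, ← map_mul, coeff_mul_C, coeff_map,
    Algebra.smul_def]

theorem coeff_inverse_formalPencil_mem (a : A) {R : ℂ⟦X⟧} (hR : constantCoeff R = 0) (m : ℕ) :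
    coeff m (Ring.inverse (formalPencil a R)) ∈ Algebra.adjoin ℂ {a} := by
  rw [coeff_inverse_formalPencil a hR le_rfl]
  exact sum_mem fun n _ => Subalgebra.smul_mem _
    (pow_mem (Algebra.self_mem_adjoin_singleton ℂ a) n) _

/-- This is `G_a(K(z)) = φ ((K(z) - a)⁻¹)`; the shift of the index is the factor `z` between that
resolvent and the inverse of the pencil. -/
theorem coeff_succ_subst_formalCauchy (a : A) {R : ℂ⟦X⟧} (hR : constantCoeff R = 0) (m : ℕ) :
    coeff (m + 1) (subst (formalInvK R) (formalCauchy φ a)) =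
      φ (coeff m (Ring.inverse (formalPencil a R))) := by
  rw [coeff_subst' (hasSubst_of_constantCoeff (constantCoeff_formalInvK R)),
    finsum_eq_sum_of_support_subset (s := Finset.range (m + 2)), Finset.sum_range_succ',
    coeff_inverse_formalPencil a hR le_rfl, map_sum]
  · rw [coeff_zero_eq_constantCoeff_apply, constantCoeff_formalCauchy, zero_smul, add_zero]
    simp only [coeff_succ_formalCauchy, map_smul, smul_eq_mul]
    refine Finset.sum_congr rfl fun n _ => ?_
    have : formalInvK R ^ (n + 1) = X * (formalInvK R ^ n * (1 + R)⁻¹) := by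
      rw [pow_succ]; nth_rw 2 [formalInvK]; ring
    rw [this, coeff_succ_X_mul, mul_comm]
  · intro d hd
    by_contra hd'
    refine hd ?_
    have : X ^ d ∣ formalInvK R ^ d := pow_dvd_pow_of_dvd (Dvd.intro _ rfl) d
    simp only [Finset.coe_range, Set.mem_Iio, not_lt] at hd'
    have h0 := X_pow_dvd_iff.1 this (m + 1) (by omega)
    simp only [h0, smul_zero]

theorem isFormalRTransform_iff_inverse (h1 : φ 1 = 1) (a : A) (R : ℂ⟦X⟧) :
    IsFormalRTransform φ a R ↔ constantCoeff R = 0 ∧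
      ∀ n, φ (coeff n (Ring.inverse (formalPencil a R))) = coeff n (1 : ℂ⟦X⟧) := by
  rw [isFormalRTransform_iff h1]
  refine and_congr_right fun hR => ?_
  simp only [← coeff_succ_subst_formalCauchy a hR]
  constructor
  · intro h n
    rw [h, coeff_X, coeff_one]
    simp
  · intro h
    ext n
    cases n with
    | zero =>
      rw [coeff_zero_eq_constantCoeff_apply, coeff_zero_X]
      exact constantCoeff_subst_eq_zero (constantCoeff_formalInvK R) _
        (constantCoeff_formalCauchy a)
    | succ n => rw [h n, coeff_X, coeff_one]; simp

variable {ι : Type*}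

/-- Freeness for products of power series with centred coefficients. -/
theorem FreeSubalgebras.coeff_prod_eq_zero {B : ι → Subalgebra ℂ A} (hB : FreeSubalgebras φ B)
    {S : ι → A⟦X⟧} (hS : ∀ i n, coeff n (S i) ∈ B i) (hφ : ∀ i n, φ (coeff n (S i)) = 0)
    {w : List ι} (hw : IsAlternating w) (h0 : w ≠ []) (n : ℕ) :
    φ (coeff n (w.map S).prod) = 0 := by
  -- Coefficients of a product are sums of products of coefficients. The word is expanded letter by
  -- letter, with the chosen coefficients collected in `l`.
  have key : ∀ (w : List ι) (l : List (ι × A)), (∀ p ∈ l, p.2 ∈ B p.1 ∧ φ p.2 = 0) →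
      l.map Prod.fst ++ w ≠ [] → IsAlternating (l.map Prod.fst ++ w) → ∀ n,
      φ ((l.map Prod.snd).prod * coeff n (w.map S).prod) = 0 := by
    intro w
    induction w with
    | nil =>
      intro l hl h0 hw n
      have h1 : φ (l.map Prod.snd).prod = 0 := hB l (by simpa using h0) hl (by
        rw [List.append_nil, IsAlternating, List.isChain_map] at hw; exact hw)
      rw [List.map_nil, List.prod_nil, coeff_one]
      split_ifs <;> simp [h1]
    | cons i w ih =>
      intro l hl h0 hw n
      rw [List.map_cons, List.prod_cons, coeff_mul, Finset.mul_sum, map_sum]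
      refine Finset.sum_eq_zero fun p _ => ?_
      have := ih (l ++ [(i, coeff p.1 (S i))]) (by
        intro q hq
        rcases List.mem_append.1 hq with hq | hq
        · exact hl q hq
        · rw [List.mem_singleton.1 hq]; exact ⟨hS i _, hφ i _⟩) (by simp) (by simpa using hw) p.2
      simpa [mul_assoc] using this
  simpa using key w [] (by simp) (by simpa using h0) (by simpa using hw) n

variable [Fintype ι]

theorem one_sub_sum_formalPencil (T : ι → A) (R : ι → ℂ⟦X⟧) :
    1 - ∑ i, (1 - formalPencil (T i) (R i)) = formalPencil (∑ i, T i) (∑ i, R i) := by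
  have h : ∀ i, 1 - formalPencil (T i) (R i) =
      X * C (T i) - PowerSeries.map (algebraMap ℂ A) (R i) := fun i => by
    rw [formalPencil]; abel
  rw [Finset.sum_congr rfl fun i _ => h i, Finset.sum_sub_distrib, ← Finset.mul_sum, ← map_sum,
    ← map_sum, formalPencil]
  abel

theorem formal_resolvent_formula (h1 : φ 1 = 1) {T : ι → A} {R : ι → ℂ⟦X⟧} (hT : IsFree φ T)
    (hR : ∀ i, IsFormalRTransform φ (T i) (R i)) :
    (∀ i, IsUnit (formalPencil (T i) (R i))) ∧
    IsUnit (formalPencil (∑ i, T i) (∑ i, R i)) ∧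
    (∀ S : ι → A⟦X⟧, (∀ i, Ring.inverse (formalPencil (T i) (R i)) = 1 + S i) →
      (∀ i n, φ (coeff n (S i)) = 0) ∧
      ∀ m : ℕ, ∀ᶠ N : ℕ in atTop,
        coeff m (1 + ∑ n ∈ Finset.range N, altSum S (n + 1)) =
        coeff m (Ring.inverse (formalPencil (∑ i, T i) (∑ i, R i)))) ∧
    (∀ n, φ (coeff n (Ring.inverse (formalPencil (∑ i, T i) (∑ i, R i)))) =
      coeff n (1 : ℂ⟦X⟧)) ∧
    IsFormalRTransform φ (∑ i, T i) (∑ i, R i) := by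
  have hu := fun i => isUnit_formalPencil (T i) (hR i).1
  have hR0 : constantCoeff (∑ i, R i) = 0 := by
    rw [map_sum]; exact Finset.sum_eq_zero fun i _ => (hR i).1
  have hU := isUnit_formalPencil (∑ i, T i) hR0
  have hcent : ∀ S : ι → A⟦X⟧, (∀ i, Ring.inverse (formalPencil (T i) (R i)) = 1 + S i) →
      ∀ i n, φ (coeff n (S i)) = 0 := fun S hS i n => by
    have := ((isFormalRTransform_iff_inverse h1 _ _).1 (hR i)).2 n
    rw [hS, map_add, map_add, coeff_one, coeff_one] at this
    split_ifs at this <;> simpa [h1] using this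
  have hconv : ∀ S : ι → A⟦X⟧, (∀ i, Ring.inverse (formalPencil (T i) (R i)) = 1 + S i) →
      ∀ m N : ℕ, m ≤ N → coeff m (1 + ∑ n ∈ Finset.range N, altSum S (n + 1)) =
        coeff m (Ring.inverse (formalPencil (∑ i, T i) (∑ i, R i))) := fun S hS m N hm => by
    have hV : ∀ i, formalPencil (T i) (R i) * (1 + S i) = 1 := fun i => by
      rw [← hS]; exact Ring.mul_inverse_cancel _ (hu i)
    -- The inverse of the pencil has constant coefficient `1`. Hence words of length `n` are
    -- divisible by `X ^ n`, and the error disappears below degree `N + 1`.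
    have hX : ∀ i, X ∣ S i := fun i => by
      rw [X_dvd_iff]
      have h2 := congrArg (coeff 0) (hS i)
      rw [coeff_inverse_formalPencil _ (hR i).1 le_rfl] at h2
      simpa [(hR i).1] using h2
    have key := mul_sum_altSum S _ hV N
    rw [one_sub_sum_formalPencil, Finset.sum_range_succ', altSum_zero, add_comm] at key
    have hdvd : X ^ (N + 1) ∣ ∑ i, formalPencil (T i) (R i) * altSumFrom S (N + 1) i :=
      Finset.dvd_sum fun i _ => X_pow_dvd_mul_left (Finset.dvd_sum fun w hw => by
        rw [← (mem_alternatingWordsFrom.1 hw).1.1]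
        exact X_pow_dvd_list_prod hX w) _
    refine (coeff_eq_of_X_pow_dvd_sub (n := N + 1) ?_ (Nat.lt_succ_of_le hm)).symm
    rw [inverse_sub_eq hU key]
    exact X_pow_dvd_mul_left hdvd _
  have hφ : ∀ n, φ (coeff n (Ring.inverse (formalPencil (∑ i, T i) (∑ i, R i)))) =
      coeff n (1 : ℂ⟦X⟧) := fun m => by
    set S : ι → A⟦X⟧ := fun i => Ring.inverse (formalPencil (T i) (R i)) - 1 with hS'
    have hS : ∀ i, Ring.inverse (formalPencil (T i) (R i)) = 1 + S i := fun i => by simp [hS']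
    rw [← hconv S hS m m le_rfl, map_add, map_add, map_sum, map_sum, Finset.sum_eq_zero, add_zero,
      coeff_one, coeff_one]
    · split_ifs <;> simp [h1]
    · intro n _
      rw [altSum, map_sum, map_sum]
      refine Finset.sum_eq_zero fun w hw => ?_
      rw [mem_alternatingWords] at hw
      refine hT.coeff_prod_eq_zero (fun i k => ?_) (hcent S hS) hw.2 (by rintro rfl; simp at hw) m
      rw [hS', map_sub, coeff_one]
      refine sub_mem (coeff_inverse_formalPencil_mem _ (hR i).1 k) ?_
      split_ifs
      exacts [one_mem _, zero_mem _]
  exact ⟨hu, hU, fun S hS => ⟨hcent S hS, fun m => (eventually_ge_atTop m).mono fun N hN =>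
    hconv S hS m N hN⟩, hφ, (isFormalRTransform_iff_inverse h1 _ _).2 ⟨hR0, hφ⟩⟩

end Formal

/-! ### The analytic version near zero. -/

section NormBounds

variable {ι A : Type*} [NormedRing A]

theorem norm_list_map_prod_le (S : ι → A) {w : List ι} (hw : w ≠ []) :
    ‖(w.map S).prod‖ ≤ (w.map fun i => ‖S i‖).prod := by
  have := List.norm_prod_le' (l := w.map S) (by simpa using hw)
  simpa [Function.comp_def] using this

variable [Finite ι]

theorem norm_altSum_le (S : ι → A) (n : ℕ) :
    ‖altSum S (n + 1)‖ ≤ altSum (fun i => ‖S i‖) (n + 1) :=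
  (norm_sum_le _ _).trans (Finset.sum_le_sum fun w hw => norm_list_map_prod_le S (by
    rintro rfl; simp [mem_alternatingWords] at hw))

theorem norm_altSumFrom_le (S : ι → A) (n : ℕ) (i : ι) :
    ‖altSumFrom S (n + 1) i‖ ≤ altSumFrom (fun i => ‖S i‖) (n + 1) i :=
  (norm_sum_le _ _).trans (Finset.sum_le_sum fun w hw => norm_list_map_prod_le S (by
    rintro rfl; simp [mem_alternatingWordsFrom] at hw))

theorem summable_altSum_of_sum_norm_lt_one [Fintype ι] [CompleteSpace A] {S : ι → A}
    (hS : ∑ i, ‖S i‖ < 1) :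
    Summable (fun n => altSum S (n + 1)) ∧
      ∀ i, Tendsto (fun n => altSumFrom S (n + 1) i) atTop (𝓝 0) := by
  have hx : ∀ i, 0 ≤ ‖S i‖ := fun i => norm_nonneg _
  have h1 : ∑ i, ‖S i‖ / (1 + ‖S i‖) < 1 :=
    (Finset.sum_le_sum fun i _ => div_le_self (hx i) (by linarith [hx i])).trans_lt hS
  have h2 := (summable_nat_add_iff 1).2 (summable_altSum_of_lt_one hx h1)
  refine ⟨Summable.of_norm_bounded h2 (norm_altSum_le S), fun i => ?_⟩
  exact squeeze_zero_norm (fun n => (norm_altSumFrom_le S n i).trans (altSumFrom_le hx _ _))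
    h2.tendsto_atTop_zero

end NormBounds

section Banach

variable {A : Type*} [NormedRing A] [NormedAlgebra ℂ A] {φ : A →L[ℂ] ℂ}

theorem isUnit_smul_iff_of_ne_zero {w : ℂ} (hw : w ≠ 0) (x : A) : IsUnit (w • x) ↔ IsUnit x :=
  isUnit_smul_iff (Units.mk0 w hw) x

theorem one_add_eq_inverse {a s : A} {z k : ℂ} (hz : z ≠ 0) (hk : (1 + k) / z ∈ resolventSet ℂ a)
    (hs : resolvent a ((1 + k) / z) = z • (1 + s)) :
    1 + s = Ring.inverse (1 - (z • a - algebraMap ℂ A k)) := by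
  have h5 : z • (algebraMap ℂ A ((1 + k) / z) - a) = 1 - (z • a - algebraMap ℂ A k) := by
    rw [smul_sub, Algebra.smul_def z (algebraMap ℂ A _), ← map_mul, mul_div_cancel₀ _ hz, map_add,
      map_one]
    abel
  rw [← h5]
  exact (Ring.inverse_unit ⟨_, _, smul_pencil_mul hk hs, mul_smul_pencil hk hs⟩).symm

theorem inv_mem_resolventSet_iff {a : A} {w : ℂ} (hw : w ≠ 0) :
    w⁻¹ ∈ resolventSet ℂ a ↔ IsUnit (1 - w • a) := by
  have : (1 : A) - w • a = w • (algebraMap ℂ A w⁻¹ - a) := by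
    rw [smul_sub, Algebra.smul_def w (algebraMap ℂ A _), ← map_mul, mul_inv_cancel₀ hw, map_one]
  rw [this, isUnit_smul_iff_of_ne_zero hw]
  rfl

theorem cauchyTransform_inv {a : A} {w : ℂ} (hw : w ≠ 0) (hu : IsUnit (1 - w • a)) :
    cauchyTransform φ.toLinearMap a w⁻¹ = w * φ (Ring.inverse (1 - w • a)) := by
  have h1 := (inv_mem_resolventSet_iff hw).2 hu
  have h2 : resolvent a w⁻¹ = w • Ring.inverse (1 - w • a) := by
    have h3 : (algebraMap ℂ A w⁻¹ - a) * (w • Ring.inverse (1 - w • a)) = 1 := by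
      rw [mul_smul_comm, ← smul_mul_assoc, smul_sub, Algebra.smul_def w (algebraMap ℂ A _),
        ← map_mul, mul_inv_cancel₀ hw, map_one, Ring.mul_inverse_cancel _ hu]
    calc resolvent a w⁻¹ = Ring.inverse (algebraMap ℂ A w⁻¹ - a) *
          ((algebraMap ℂ A w⁻¹ - a) * (w • Ring.inverse (1 - w • a))) := by
          rw [h3, mul_one]; rfl
      _ = _ := by rw [← mul_assoc, Ring.inverse_mul_cancel _ h1, one_mul]
  rw [cauchyTransform, h2]
  exact map_smul φ _ _

theorem tendsto_kTransform {R : ℂ → ℂ} (hR : ContinuousAt R 0) (hR0 : R 0 = 0) :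
    Tendsto (kTransform R) (𝓝[≠] 0) (Bornology.cobounded ℂ) := by
  have h1 : Tendsto (fun z => z / (1 + R z)) (𝓝[≠] 0) (𝓝[≠] 0) := by
    have h2 : ContinuousAt (fun z => z / (1 + R z)) 0 :=
      continuousAt_id.div (continuousAt_const.add hR) (by simp [hR0])
    have h3 : ∀ᶠ z in 𝓝 (0 : ℂ), 1 + R z ≠ 0 :=
      (continuousAt_const.add hR).eventually_ne (by simp [hR0])
    refine tendsto_nhdsWithin_iff.2 ⟨?_, ?_⟩
    · have := h2.tendsto
      simp only [zero_div] at this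
      exact this.mono_left nhdsWithin_le_nhds
    · rw [eventually_nhdsWithin_iff]
      filter_upwards [h3] with z hz hz0
      exact div_ne_zero hz0 hz
  have h4 := tendsto_inv₀_nhdsNE_zero.comp h1
  refine h4.congr fun z => ?_
  simp [kTransform]

/-- A function `R` with `G_a(K(z)) = z` near `0` is determined by `a`. -/
theorem IsRTransform.eventuallyEq {φ : A →ₗ[ℂ] ℂ} {a : A} {R R' : ℂ → ℂ}
    (hR' : IsRTransform φ a R') (hR : ContinuousAt R 0) (hR0 : R 0 = 0)
    (hG : ∀ᶠ z in 𝓝[≠] (0 : ℂ), cauchyTransform φ a (kTransform R z) = z) : R =ᶠ[𝓝 0] R' := by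
  have h1 := (tendsto_kTransform hR hR0).eventually hR'.2.2.2
  have h2 : ∀ᶠ z in 𝓝[≠] (0 : ℂ), R z = R' z := by
    -- Evaluating `K' ∘ G = id` at the large point `K(z)`, where `G(K(z)) = z`, gives `K'(z) =
    -- K(z)`.
    filter_upwards [h1, hG, self_mem_nhdsWithin] with z hz hGz hz0
    have hz0' : z ≠ 0 := hz0
    have h3 := hz.2
    rw [hGz, kTransform, kTransform] at h3
    field_simp at h3
    linear_combination -h3
  rw [eventually_nhdsWithin_iff] at h2
  filter_upwards [h2] with z hz
  by_cases hz0 : z = 0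
  · rw [hz0, hR0, hR'.2.1]
  · exact hz hz0

variable [CompleteSpace A]

theorem inverse_one_sub_mem_closure {B : Subalgebra ℂ A} {y : A} (hy : y ∈ B) (h : ‖y‖ < 1) :
    Ring.inverse (1 - y) ∈ B.topologicalClosure := by
  rw [NormedRing.inverse_one_sub y h]
  have hs := (summable_geometric_of_norm_lt_one h).hasSum
  change ∑' n : ℕ, y ^ n ∈ closure (B : Set A)
  exact mem_closure_of_tendsto hs (Eventually.of_forall fun s => sum_mem fun n _ => pow_mem hy n)

/-- In a Banach algebra inverses may leave a closed subalgebra, so `hy` places `S i` in the closed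
algebra of `T i` by a Neumann series. As `K - T` is invertible by `hK`, a one-sided inverse
suffices. -/
theorem banach_resolvent_formula {ι : Type*} [Fintype ι] (h1 : φ 1 = 1) {T S : ι → A}
    {r : ι → ℂ} {z : ℂ} (hT : IsFree φ.toLinearMap T) (hz : z ≠ 0)
    (hk : ∀ i, (1 + r i) / z ∈ resolventSet ℂ (T i))
    (hG : ∀ i, cauchyTransform φ.toLinearMap (T i) ((1 + r i) / z) = z)
    (hS : ∀ i, resolvent (T i) ((1 + r i) / z) = z • (1 + S i))
    (hy : ∀ i, ‖z • T i - algebraMap ℂ A (r i)‖ < 1)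
    (hK : (1 + ∑ i, r i) / z ∈ resolventSet ℂ (∑ i, T i)) (hx : ∑ i, ‖S i‖ < 1) :
    φ (resolvent (∑ i, T i) ((1 + ∑ i, r i) / z)) = z ∧ (∀ i, φ (S i) = 0) ∧
      ∃ s : A, HasSum (fun n : ℕ => altSum S (n + 1)) s ∧
        resolvent (∑ i, T i) ((1 + ∑ i, r i) / z) = z • (1 + s) := by
  have hφS : ∀ i, φ (S i) = 0 := fun i =>
    apply_eq_zero_of_cauchyTransform (φ := φ.toLinearMap) h1 hz (hG i) (hS i)
  obtain ⟨⟨s, hs⟩, hF⟩ := summable_altSum_of_sum_norm_lt_one hx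
  have hV := fun i => smul_pencil_mul (hk i) (hS i)
  have h2 := mul_one_add_eq_one hV hs hF
  rw [one_sub_sum_pencil hz] at h2
  have hu : IsUnit (z • (algebraMap ℂ A ((1 + ∑ i, r i) / z) - ∑ i, T i)) :=
    (isUnit_smul_iff_of_ne_zero hz _).2 hK
  have h3 : (1 + s) * z • (algebraMap ℂ A ((1 + ∑ i, r i) / z) - ∑ i, T i) = 1 := by
    obtain ⟨U, hU⟩ := hu
    rw [← hU] at h2 ⊢
    rw [← Units.inv_eq_of_mul_eq_one_right h2, Units.inv_mul]
  have h4 := (resolvent_of_smul_pencil h2 h3).2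
  have hmem : ∀ i, S i ∈ (Algebra.adjoin ℂ {T i}).topologicalClosure := fun i => by
    have h7 : S i = Ring.inverse (1 - (z • T i - algebraMap ℂ A (r i))) - 1 := by
      rw [← one_add_eq_inverse hz (hk i) (hS i)]; abel
    rw [h7]
    exact sub_mem (inverse_one_sub_mem_closure (sub_mem (Subalgebra.smul_mem _
      (Algebra.self_mem_adjoin_singleton ℂ _) _) (Subalgebra.algebraMap_mem _ _)) (hy i))
      (one_mem _)
  refine ⟨?_, hφS, s, hs, h4⟩
  have h8 : φ s = 0 := by
    have h9 : HasSum (fun n => φ (altSum S (n + 1))) (φ s) := hs.mapL φ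
    refine h9.unique ?_
    simp only [show ∀ n, φ (altSum S (n + 1)) = 0 from
      (FreeSubalgebras.closure h1 hT).altSum_eq_zero hmem hφS]
    exact hasSum_zero
  rw [h4, map_smul, map_add, h8, h1]
  simp

theorem eventually_isUnit_one_sub_smul (a : A) : ∀ᶠ w : ℂ in 𝓝 0, IsUnit (1 - w • a) := by
  have h : ContinuousAt (fun w : ℂ => 1 - w • a) 0 := by fun_prop
  exact h.eventually (Units.isOpen.eventually_mem (by simp))

/-- With `w = 1/ζ` the Cauchy transform is `g w = w f w`, where `f` is analytic and `f 0 = 1`. It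
has a local inverse `h`, and `K(z) = 1 / h z = f (h z) / z`, whence `R = f ∘ h - 1`. -/
theorem exists_isRTransform (h1 : φ 1 = 1) (a : A) :
    ∃ R : ℂ → ℂ, IsRTransform φ.toLinearMap a R := by
  set f : ℂ → ℂ := fun w => φ (Ring.inverse (1 - w • a)) with hf
  have hfa : AnalyticAt ℂ f 0 := by
    have h2 : AnalyticAt ℂ (fun w : ℂ => 1 - w • a) 0 := by fun_prop
    have h3 : AnalyticAt ℂ (Ring.inverse : A → A) (1 - (0 : ℂ) • a) := by
      simpa using analyticAt_inverse (𝕜 := ℂ) (1 : Aˣ)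
    have h4 : AnalyticAt ℂ (fun w : ℂ => Ring.inverse (1 - w • a)) 0 :=
      AnalyticAt.comp (g := Ring.inverse) (f := fun w : ℂ => 1 - w • a) h3 h2
    exact AnalyticAt.comp (g := φ) (f := fun w : ℂ => Ring.inverse (1 - w • a))
      (φ.analyticAt _) h4
  have hf0 : f 0 = 1 := by simp [hf, h1]
  have hfne : ∀ᶠ w in 𝓝 0, f w ≠ 0 := hfa.continuousAt.eventually_ne (by simp [hf0])
  set g : ℂ → ℂ := fun w => w * f w with hg
  have hga : AnalyticAt ℂ g 0 := analyticAt_id.mul hfa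
  have hg0 : g 0 = 0 := by simp [hg]
  have hg' : deriv g 0 = 1 := by
    have := (hasDerivAt_id (0 : ℂ)).mul hfa.differentiableAt.hasDerivAt
    have h2 := this.deriv
    simp only [id, hf0, one_mul, zero_mul, add_zero] at h2
    exact h2
  have hne : deriv g 0 ≠ 0 := by simp [hg']
  set h := hga.hasStrictDerivAt.localInverse g _ _ hne with hh
  have hha : AnalyticAt ℂ h 0 := by
    have := hga.analyticAt_localInverse hne
    rwa [hg0] at this
  have hgh : ∀ᶠ z in 𝓝 0, g (h z) = z := by
    have := hga.hasStrictDerivAt.eventually_right_inverse (hf' := hne)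
    rwa [hg0] at this
  have hhg : ∀ᶠ w in 𝓝 0, h (g w) = w := hga.hasStrictDerivAt.eventually_left_inverse hne
  have hh0 : h 0 = 0 := by
    have := hhg.self_of_nhds
    rwa [hg0] at this
  have hht : Tendsto h (𝓝 0) (𝓝 0) := by
    have := hha.continuousAt.tendsto
    rwa [hh0] at this
  refine ⟨fun z => f (h z) - 1, ?_, by simp [hh0, hf0], ?_, ?_⟩
  · refine AnalyticAt.sub ?_ analyticAt_const
    exact AnalyticAt.comp (g := f) (f := h) (by rwa [hh0]) hha
  · rw [eventually_nhdsWithin_iff]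
    filter_upwards [hgh, hht.eventually hfne, hht.eventually (eventually_isUnit_one_sub_smul a)]
      with z hz hfz hu hz0
    have hhz : h z ≠ 0 := fun h0 => hz0 (by rw [← hz, h0, hg0]; rfl)
    have hK : kTransform (fun z => f (h z) - 1) z = (h z)⁻¹ := by
      rw [kTransform, add_sub_cancel]
      nth_rw 2 [← hz]
      rw [hg]
      field_simp
    rw [hK]
    exact ⟨(inv_mem_resolventSet_iff hhz).2 hu, (cauchyTransform_inv hhz hu).trans hz⟩
  · have h2 : ∀ᶠ w in 𝓝[≠] (0 : ℂ), w⁻¹ ∈ resolventSet ℂ a ∧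
        kTransform (fun z => f (h z) - 1) (cauchyTransform φ.toLinearMap a w⁻¹) = w⁻¹ := by
      rw [eventually_nhdsWithin_iff]
      filter_upwards [hhg, hfne, eventually_isUnit_one_sub_smul a] with w hw hfw hu hw0
      have hw0' : w ≠ 0 := hw0
      refine ⟨(inv_mem_resolventSet_iff hw0').2 hu, ?_⟩
      rw [cauchyTransform_inv hw0' hu, kTransform, add_sub_cancel]
      change f (h (g w)) / (w * f w) = _
      rw [hw]
      field_simp
    filter_upwards [tendsto_inv₀_cobounded'.eventually h2] with ζ hζ
    simpa using hζ

theorem tendsto_cauchyTransform (a : A) :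
    Tendsto (cauchyTransform φ.toLinearMap a) (Bornology.cobounded ℂ) (𝓝 0) := by
  have := (φ.continuous.tendsto 0).comp (spectrum.resolvent_tendsto_cobounded (𝕜 := ℂ) a)
  rwa [map_zero] at this

/-- An `R`-transform exists, and `G(K(z)) = z` already forces `R` to agree with it near `0`; the
other composition is inherited. -/
theorem isRTransform_of_cauchyTransform (h1 : φ 1 = 1) {a : A} {R : ℂ → ℂ}
    (hR : AnalyticAt ℂ R 0) (hR0 : R 0 = 0)
    (hG : ∀ᶠ z in 𝓝[≠] (0 : ℂ), kTransform R z ∈ resolventSet ℂ a ∧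
      cauchyTransform φ.toLinearMap a (kTransform R z) = z) : IsRTransform φ.toLinearMap a R := by
  obtain ⟨R', hR'⟩ := exists_isRTransform h1 a
  have h2 := hR'.eventuallyEq hR.continuousAt hR0 (hG.mono fun z hz => hz.2)
  refine ⟨hR, hR0, hG, ?_⟩
  filter_upwards [hR'.2.2.2, (tendsto_cauchyTransform (φ := φ) a).eventually h2] with ζ hζ h3
  refine ⟨hζ.1, ?_⟩
  have h4 := hζ.2
  rw [kTransform] at h4 ⊢
  rw [h3]
  exact h4

theorem IsRTransform.sum {ι : Type*} [Fintype ι] (h1 : φ 1 = 1) {T : ι → A} {R : ι → ℂ → ℂ}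
    (hT : IsFree φ.toLinearMap T) (hR : ∀ i, IsRTransform φ.toLinearMap (T i) (R i)) :
    (∀ᶠ z in 𝓝[≠] (0 : ℂ),
      (∀ i, kTransform (R i) z ∈ resolventSet ℂ (T i)) ∧
      kTransform (∑ i, R i) z ∈ resolventSet ℂ (∑ i, T i) ∧
      φ (resolvent (∑ i, T i) (kTransform (∑ i, R i) z)) = z ∧
      ∀ S : ι → A, (∀ i, resolvent (T i) (kTransform (R i) z) = z • (1 + S i)) →
        (∀ i, φ (S i) = 0) ∧
        ∃ s : A, HasSum (fun n : ℕ => altSum S (n + 1)) s ∧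
          resolvent (∑ i, T i) (kTransform (∑ i, R i) z) = z • (1 + s)) ∧
    IsRTransform φ.toLinearMap (∑ i, T i) (∑ i, R i) := by
  have hRa : AnalyticAt ℂ (∑ i, R i) 0 := Finset.analyticAt_sum _ fun i _ => (hR i).1
  have hR0 : (∑ i, R i) 0 = 0 := by
    rw [Finset.sum_apply]
    exact Finset.sum_eq_zero fun i _ => (hR i).2.1
  have hA := eventually_all.2 fun i => (hR i).2.2.1
  have hy0 : ∀ i, ContinuousAt (fun z : ℂ => z • T i - algebraMap ℂ A (R i z)) 0 := fun i =>
    (continuousAt_id.smul continuousAt_const).sub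
      ((algebraMapCLM ℂ A).continuous.continuousAt.comp (hR i).1.continuousAt)
  have hy00 : ∀ i, (0 : ℂ) • T i - algebraMap ℂ A (R i 0) = 0 := fun i => by
    rw [(hR i).2.1, zero_smul, map_zero, sub_zero]
  have hB : ∀ᶠ z in 𝓝 (0 : ℂ), ∀ i, ‖z • T i - algebraMap ℂ A (R i z)‖ < 1 :=
    eventually_all.2 fun i => (hy0 i).norm.eventually_lt_const (by
      simp only [hy00 i, norm_zero, one_pos])
  have hC : ∀ᶠ z in 𝓝[≠] (0 : ℂ), kTransform (∑ i, R i) z ∈ resolventSet ℂ (∑ i, T i) := by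
    obtain ⟨R', hR'⟩ := exists_isRTransform h1 (∑ i, T i)
    exact (tendsto_kTransform hRa.continuousAt hR0).eventually (hR'.2.2.2.mono fun _ h => h.1)
  -- The sum is `∑ ‖S i‖` with `1 + S i` written as the inverse of `1 - (z T_i - R_i(z))`, which is
  -- continuous and equal to `1` at `z = 0`.
  have hD : ∀ᶠ z in 𝓝 (0 : ℂ),
      ∑ i, ‖Ring.inverse (1 - (z • T i - algebraMap ℂ A (R i z))) - 1‖ < 1 := by
    have hc : ContinuousAt (fun z : ℂ =>
        ∑ i, ‖Ring.inverse (1 - (z • T i - algebraMap ℂ A (R i z))) - 1‖) 0 := by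
      refine tendsto_finsetSum _ fun i _ => (ContinuousAt.sub ?_ continuousAt_const).norm
      refine ContinuousAt.comp (g := Ring.inverse)
        (f := fun z : ℂ => 1 - (z • T i - algebraMap ℂ A (R i z))) ?_
        (continuousAt_const.sub (hy0 i))
      rw [hy00 i, sub_zero]
      exact NormedRing.inverse_continuousAt (1 : Aˣ)
    refine hc.eventually_lt_const ?_
    simp only [hy00, sub_zero, Ring.inverse_one, sub_self, norm_zero, Finset.sum_const_zero,
      one_pos]
  have hE : ∀ᶠ z in 𝓝[≠] (0 : ℂ),
      (∀ i, kTransform (R i) z ∈ resolventSet ℂ (T i)) ∧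
      kTransform (∑ i, R i) z ∈ resolventSet ℂ (∑ i, T i) ∧
      φ (resolvent (∑ i, T i) (kTransform (∑ i, R i) z)) = z ∧
      ∀ S : ι → A, (∀ i, resolvent (T i) (kTransform (R i) z) = z • (1 + S i)) →
        (∀ i, φ (S i) = 0) ∧
        ∃ s : A, HasSum (fun n : ℕ => altSum S (n + 1)) s ∧
          resolvent (∑ i, T i) (kTransform (∑ i, R i) z) = z • (1 + s) := by
    filter_upwards [hA, hB.filter_mono nhdsWithin_le_nhds, hC, hD.filter_mono nhdsWithin_le_nhds,
      self_mem_nhdsWithin] with z hAz hBz hCz hDz hz0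
    have hz : z ≠ 0 := hz0
    have hk := fun i => (hAz i).1
    have hmain : ∀ S : ι → A, (∀ i, resolvent (T i) (kTransform (R i) z) = z • (1 + S i)) →
        φ (resolvent (∑ i, T i) (kTransform (∑ i, R i) z)) = z ∧ (∀ i, φ (S i) = 0) ∧
          ∃ s : A, HasSum (fun n : ℕ => altSum S (n + 1)) s ∧
            resolvent (∑ i, T i) (kTransform (∑ i, R i) z) = z • (1 + s) := by
      intro S hS
      simp only [kTransform, Finset.sum_apply] at hk hS hCz ⊢
      refine banach_resolvent_formula h1 hT hz hk (fun i => (hAz i).2) hS hBz hCz ?_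
      refine lt_of_eq_of_lt (Finset.sum_congr rfl fun i _ => ?_) hDz
      rw [← one_add_eq_inverse hz (hk i) (hS i), add_sub_cancel_left]
    refine ⟨hk, hCz, (hmain (fun i => z⁻¹ • resolvent (T i) (kTransform (R i) z) - 1)
      fun i => ?_).1, fun S hS => (hmain S hS).2⟩
    rw [add_sub_cancel, smul_inv_smul₀ hz]
  exact ⟨hE, isRTransform_of_cauchyTransform h1 hRa hR0 (hE.mono fun z hz => ⟨hz.2.1, hz.2.2.1⟩)⟩

end Banach

end FreeProb

/-! ### The three versions together. -/

theorem mainTheorem1 {ι : Type v} [Fintype ι] :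
    -- formal power series, in an arbitrary non-commutative probability space
    (∀ (A : Type u) [Ring A] [Algebra ℂ A] (φ : A →ₗ[ℂ] ℂ), φ 1 = 1 →
      (∀ a : A, ∃! R : PowerSeries ℂ, FreeProb.IsFormalRTransform φ a R) ∧
      ∀ (T : ι → A) (R : ι → PowerSeries ℂ), FreeProb.IsFree φ T →
        (∀ i, FreeProb.IsFormalRTransform φ (T i) (R i)) →
        (∀ i, IsUnit (FreeProb.formalPencil (T i) (R i))) ∧
        IsUnit (FreeProb.formalPencil (∑ i, T i) (∑ i, R i)) ∧
        (∀ S : ι → PowerSeries A,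
          (∀ i, Ring.inverse (FreeProb.formalPencil (T i) (R i)) = 1 + S i) →
          (∀ i n, φ (PowerSeries.coeff n (S i)) = 0) ∧
          ∀ m : ℕ, ∀ᶠ N : ℕ in Filter.atTop,
            PowerSeries.coeff m (1 + ∑ n ∈ Finset.range N, FreeProb.altSum S (n + 1)) =
            PowerSeries.coeff m
              (Ring.inverse (FreeProb.formalPencil (∑ i, T i) (∑ i, R i)))) ∧
        (∀ n, φ (PowerSeries.coeff n
            (Ring.inverse (FreeProb.formalPencil (∑ i, T i) (∑ i, R i)))) =
          PowerSeries.coeff n (1 : PowerSeries ℂ)) ∧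
        FreeProb.IsFormalRTransform φ (∑ i, T i) (∑ i, R i)) ∧
    -- convergent version near `z = 0`, in a Banach algebra with a continuous unital functional
    (∀ (A : Type u) [NormedRing A] [NormedAlgebra ℂ A] [CompleteSpace A] (φ : A →L[ℂ] ℂ),
      φ 1 = 1 →
      (∀ a : A, (∃ R : ℂ → ℂ, FreeProb.IsRTransform φ.toLinearMap a R) ∧
        ∀ R R' : ℂ → ℂ, FreeProb.IsRTransform φ.toLinearMap a R →
          FreeProb.IsRTransform φ.toLinearMap a R' → R =ᶠ[nhds 0] R') ∧
      ∀ (T : ι → A) (R : ι → ℂ → ℂ), FreeProb.IsFree φ.toLinearMap T →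
        (∀ i, FreeProb.IsRTransform φ.toLinearMap (T i) (R i)) →
        (∀ᶠ z in nhdsWithin (0 : ℂ) {0}ᶜ,
          (∀ i, FreeProb.kTransform (R i) z ∈ resolventSet ℂ (T i)) ∧
          FreeProb.kTransform (∑ i, R i) z ∈ resolventSet ℂ (∑ i, T i) ∧
          φ (resolvent (∑ i, T i) (FreeProb.kTransform (∑ i, R i) z)) = z ∧
          ∀ S : ι → A,
            (∀ i, resolvent (T i) (FreeProb.kTransform (R i) z) = z • (1 + S i)) →
            (∀ i, φ (S i) = 0) ∧
            ∃ s : A, HasSum (fun n : ℕ => FreeProb.altSum S (n + 1)) s ∧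
              resolvent (∑ i, T i) (FreeProb.kTransform (∑ i, R i) z) = z • (1 + s)) ∧
        FreeProb.IsRTransform φ.toLinearMap (∑ i, T i) (∑ i, R i)) ∧
    -- at a given point `z ≠ 0` with `G_i(K_i) = z`, `K_i = (1 + r_i) / z`, in a `C*`-algebra with a
    -- state `φ`
    (∀ (A : Type u) [CStarAlgebra A] [PartialOrder A] [StarOrderedRing A] (φ : A →ₚ[ℂ] ℂ),
      φ 1 = 1 →
      ∀ (T S : ι → A) (z : ℂ) (r : ι → ℂ), FreeProb.IsStarFree φ.toLinearMap T → z ≠ 0 →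
        (∀ i, (1 + r i) / z ∈ resolventSet ℂ (T i)) →
        (∀ i, FreeProb.cauchyTransform φ.toLinearMap (T i) ((1 + r i) / z) = z) →
        (∀ i, resolvent (T i) ((1 + r i) / z) = z • (1 + S i)) →
        (∀ i, φ (S i) = 0) ∧
        -- the resolvent formula whenever the sum over all alternating words converges in norm
        (∀ s : A,
          HasSum (fun w : {w : List ι // w ≠ [] ∧ FreeProb.IsAlternating w} =>
            (w.1.map S).prod) s →
          (1 + ∑ i, r i) / z ∈ resolventSet ℂ (∑ i, T i) ∧
          resolvent (∑ i, T i) ((1 + ∑ i, r i) / z) = z • (1 + s) ∧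
          φ (resolvent (∑ i, T i) ((1 + ∑ i, r i) / z)) = z) ∧
        -- convergence in `L²(φ)`; `ψ` is the vector `(K(z) - ∑ T_i)⁻¹` of `L²(φ)`
        (∑ i, FreeProb.l2Norm φ (S i) ^ 2 / (1 + FreeProb.l2Norm φ (S i) ^ 2) < 1 →
          ∃ (s ψ : φ.GNS) (σ : ℝ),
            HasSum (fun n : ℕ => FreeProb.toL2 φ (FreeProb.altSum S (n + 1))) s ∧
            ψ = z • (FreeProb.toL2 φ 1 + s) ∧
            φ.gnsStarAlgHom
              (algebraMap ℂ A ((1 + ∑ i, r i) / z) - ∑ i, T i) ψ = FreeProb.toL2 φ 1 ∧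
            ((1 + ∑ i, r i) / z ∈ resolventSet ℂ (∑ i, T i) →
              FreeProb.toL2 φ (resolvent (∑ i, T i) ((1 + ∑ i, r i) / z)) = ψ) ∧
            inner ℂ (FreeProb.toL2 φ 1) ψ = z ∧
            HasSum (fun n : ℕ =>
              FreeProb.altSum (fun i => FreeProb.l2Norm φ (S i) ^ 2) (n + 1)) σ ∧
            ‖ψ‖ ^ 2 = ‖z‖ ^ 2 * (1 + σ) ∧
            ‖ψ‖ ^ 2 = ‖z‖ ^ 2 *
              (1 - ∑ i, FreeProb.l2Norm φ (S i) ^ 2 / (1 + FreeProb.l2Norm φ (S i) ^ 2))⁻¹ ∧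
            ‖ψ‖ ^ 2 = ‖z‖ ^ 2 *
              (1 - ∑ i, (1 - ‖z‖ ^ 2 /
                FreeProb.l2Norm φ (resolvent (T i) ((1 + r i) / z)) ^ 2))⁻¹) ∧
        -- boundedness in operator norm, for a faithful tracial state
        ((∀ a : A, φ (star a * a) = 0 → a = 0) → (∀ a b : A, φ (a * b) = φ (b * a)) →
          Summable (fun n : ℕ => FreeProb.toL2 φ (FreeProb.altSum S (n + 1))) →
          (1 + ∑ i, r i) / z ∈ resolventSet ℂ (∑ i, T i) ∧
          φ (resolvent (∑ i, T i) ((1 + ∑ i, r i) / z)) = z ∧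
          ∃ s : A, HasSum (fun n : ℕ => FreeProb.altSum S (n + 1)) s ∧
            resolvent (∑ i, T i) ((1 + ∑ i, r i) / z) = z • (1 + s)))
    := by
  refine ⟨fun A _ _ φ h1 => ⟨FreeProb.existsUnique_isFormalRTransform h1,
    fun T R hT hR => FreeProb.formal_resolvent_formula h1 hT hR⟩,
    fun A _ _ _ φ h1 => ⟨fun a => ⟨FreeProb.exists_isRTransform h1 a, fun R R' hR hR' =>
      hR'.eventuallyEq hR.1.continuousAt hR.2.1 (hR.2.2.1.mono fun _ h => h.2)⟩,
      fun T R hT hR => FreeProb.IsRTransform.sum h1 hT hR⟩, ?_⟩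
  intro A _ _ _ φ h1 T S z r hT hz hk hG hS
  have hfam := FreeProb.isCenteredFreeFamily_of_resolvent h1 hT hz hk hG hS
  exact ⟨hfam.centered,
    fun s hs => FreeProb.resolvent_of_hasSum hfam hz hk hS (FreeProb.hasSum_altSum_of_words hs)
      (FreeProb.tendsto_altSumFrom_of_words hs.summable)
      (FreeProb.tendsto_altSumFrom_of_words (FreeProb.summable_op_words hs.summable)),
    FreeProb.l2_resolvent_formula hfam hz hk hS,
    FreeProb.bounded_resolvent_formula hfam hz hk hS⟩
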